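/- Let $I\subseteq\mathbb{R}$ be an interval with more than one point (for example $I=\mathbb{R}$ or a compact interval). The Geroch group $G$ is the group of smooth maps $s:I\to SL(2,\mathbb{R})$ under pointwise multiplication, and the phase space $\Gamma$ is the set of smooth functions $\mathcal{M}$ from $I$ to the real symmetric positive definite $2\times2$ matrices of determinant $1$. The group $G$ acts on $\Gamma$ by $(s\triangleright\mathcal{M})(w)=s(w)\,\mathcal{M}(w)\,s(w)^t$. An observable on $G$ or $\Gamma$ is a real functional $F$ which at each point $x$ has a functional derivative $\delta F/\delta x$, that is, a smooth $2\times 2$ matrix function with compact support in the interior of $I$ such that $\frac{d}{dt}F(x_t)|_{t=0}=\int\sum_{ij}\frac{\delta F}{\delta x(w)_{ij}}\,\partial_t x_t(w)_{ij}|_{t=0}\,dw$ for every smooth curve $x_t$ with $x_0=x$. For matrices $A,B$ write $\overset{1}{A}=A\otimes 1$ and $\overset{2}{B}=1\otimes B$; let $\Omega_a{}^b{}_c{}^d=\delta_a^d\delta_c^b-\frac12\delta_a^b\delta_c^d$ be the Casimir element of $\mathfrak{sl}_2$, and let ${}^t\Omega$, $\Omega^t$, ${}^t\Omega^t$ denote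 its transposes in space $1$, in space $2$, and in both. The Poisson bracket on $\Gamma$ is $$\{A,B\}_\Gamma=\iint \frac{\delta A}{\delta\mathcal{M}(v)_{ab}}\,\frac{\delta B}{\delta\mathcal{M}(w)_{cd}}\,\{\mathcal{M}(v)_{ab},\mathcal{M}(w)_{cd}\}\,dv\,dw,$$ $$\{\overset{1}{\mathcal{M}}(v),\overset{2}{\mathcal{M}}(w)\}=\mathrm{p.v.}\Big(\frac1{v-w}\Big)\Big[\Omega\overset{1}{\mathcal{M}}(v)\overset{2}{\mathcal{M}}(w)+\overset{1}{\mathcal{M}}(v)\,{}^t\Omega\,\overset{2}{\mathcal{M}}(w)+\overset{2}{\mathcal{M}}(w)\,\Omega^t\,\overset{1}{\mathcal{M}}(v)+\overset{1}{\mathcal{M}}(v)\overset{2}{\mathcal{M}}(w)\,{}^t\Omega^t\Big],$$ where $\mathrm{p.v.}\frac1u=\lim_{\epsilon\to0^+}\frac12\big(\frac1{u+i\epsilon}+\frac1{u-i\epsilon}\big)$ as a distribution. Let $\{\cdot,\cdot\}_G$ be any bracket on $G$: a skew-symmetric bilinear operation, taking pairs of observables on $G$ to functions on $G$, that satisfies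 the Leibniz rule and depends at each point of $G$ on the observables only through their functional derivatives at that point. (The Jacobi identity is not required, so every Poisson bracket is included.) Then the action is a Poisson map $G\times\Gamma\to\Gamma$, meaning that $$\{A,B\}_\Gamma(g\triangleright\xi)=\{A(g\triangleright\cdot),B(g\triangleright\cdot)\}_\Gamma(\xi)+\{A(\cdot\triangleright\xi),B(\cdot\triangleright\xi)\}_G(g)$$ for all observables $A,B$ on $\Gamma$, all $g\in G$ and all $\xi\in\Gamma$, if and only if $\{\cdot,\cdot\}_G$ is the Sklyanin bracket, $$\{\overset{1}{s}(v),\overset{2}{s}(w)\}_G=\mathrm{p.v.}\Big(\frac1{v-w}\Big)\big[\Omega,\overset{1}{s}(v)\overset{2}{s}(w)\big],$$ as an identity between distributions in $v$ and $w$ (that is, after integration against $\varphi(v)\psi(w)$ for all smooth $\varphi,\psi$ with compact support in the interior of $I$). Moreover, a bracket on $G$ with this property exists. -/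

import Mathlib

open MeasureTheory Filter Topology Matrix
open scoped ContDiff Kronecker MatrixGroups

noncomputable section

namespace Geroch

/-- Real `2 × 2` matrices. -/
abbrev Mat : Type := Matrix (Fin 2) (Fin 2) ℝ

/-- Matrices acting on the tensor product of two copies of `ℝ²` (space 1 ⊗ space 2). A tensor
`X_a^b_c^d`, with `a, b` referring to space 1 and `c, d` to space 2, has entry `X (a, c) (b, d)`. -/
abbrev Mat₂ : Type := Matrix (Fin 2 × Fin 2) (Fin 2 × Fin 2) ℝ

/-- A matrix valued function is smooth on `I` if all its matrix elements are. -/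
def SmoothOn (I : Set ℝ) (m : ℝ → Mat) : Prop :=
  ∀ i j, ContDiffOn ℝ ∞ (fun w => m w i j) I

theorem SmoothOn.mul {I : Set ℝ} {m n : ℝ → Mat} (hm : SmoothOn I m) (hn : SmoothOn I n) :
    SmoothOn I (fun w => m w * n w) := by
  intro i j
  simp only [Matrix.mul_apply]
  exact ContDiffOn.sum fun k _ => (hm i k).mul (hn k j)

theorem SmoothOn.transpose {I : Set ℝ} {m : ℝ → Mat} (hm : SmoothOn I m) :
    SmoothOn I (fun w => (m w)ᵀ) := fun i j => hm j i

theorem SmoothOn.adjugate {I : Set ℝ} {m : ℝ → Mat} (hm : SmoothOn I m) :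
    SmoothOn I (fun w => (m w).adjugate) := by
  intro i j
  simp only [Matrix.adjugate_fin_two]
  fin_cases i <;> fin_cases j <;> simp
  · exact hm 1 1
  · exact (hm 0 1).neg
  · exact (hm 1 0).neg
  · exact hm 0 0

/-! ### The Geroch group, the phase space and the action

`I` is the interval on which the spectral parameter `w` ranges (`I = Set.univ` for the whole
line). A function on `I` is represented by its extension to `ℝ` with the dummy value `1`
off `I`; nothing below looks at the values off `I`. -/

/-- The Geroch group: the smooth functions `s : I → SL(2, ℝ)` under pointwise multiplication. -/
def Group (I : Set ℝ) : Subgroup (ℝ → SL(2, ℝ)) where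
  carrier := {s | SmoothOn I (fun w => (s w : Mat)) ∧ ∀ w, w ∉ I → s w = 1}
  mul_mem' := by
    rintro s t ⟨hs, hs'⟩ ⟨ht, ht'⟩
    refine ⟨?_, fun w hw => by simp [hs' w hw, ht' w hw]⟩
    simpa using hs.mul ht
  one_mem' := ⟨fun i j => by simpa using contDiffOn_const, fun _ _ => rfl⟩
  inv_mem' := by
    rintro s ⟨hs, hs'⟩
    refine ⟨?_, fun w hw => by simp [hs' w hw]⟩
    simpa [Matrix.SpecialLinearGroup.coe_inv] using hs.adjugate

/-- The phase space `Γ` of deformed metrics: the smooth functions from `I` to the real symmetric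
positive definite matrices of determinant `1`. -/
def PhaseSpace (I : Set ℝ) : Type :=
  {M : ℝ → Mat // SmoothOn I M ∧ (∀ w, (M w).PosDef ∧ (M w).det = 1) ∧ ∀ w, w ∉ I → M w = 1}

/-- The matrix elements of `s` as functions of `w`, the coordinates on the Geroch group. -/
def groupCoord (I : Set ℝ) (s : Group I) (w : ℝ) : Mat := ((s : ℝ → SL(2, ℝ)) w : Mat)

/-- The matrix elements of `M` as functions of `w`, the coordinates on the phase space. -/
def phaseCoord (I : Set ℝ) (M : PhaseSpace I) (w : ℝ) : Mat := M.1 w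

/-- The action `M(w) ↦ s(w) M(w) s(w)ᵗ` of the Geroch group on the phase space. -/
instance (I : Set ℝ) : MulAction (Group I) (PhaseSpace I) where
  smul s M := ⟨fun w => groupCoord I s w * M.1 w * (groupCoord I s w)ᵀ, by
    obtain ⟨M, hM, hM', hM''⟩ := M
    obtain ⟨s, hs, hs'⟩ := s
    refine ⟨(hs.mul hM).mul hs.transpose, fun w => ⟨?_, ?_⟩, fun w hw => ?_⟩
    · have h := (hM' w).1.mul_mul_conjTranspose_same (B := (s w : Mat)) (by
        apply Matrix.vecMul_injective_of_isUnit
        rw [Matrix.isUnit_iff_isUnit_det]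
        simp)
      simpa [groupCoord, Matrix.conjTranspose_eq_transpose_of_trivial] using h
    · simp [groupCoord, (hM' w).2]
    · simp [groupCoord, hs' w hw, hM'' w hw]⟩
  one_smul M := Subtype.ext (funext fun w => by
    change groupCoord I 1 w * M.1 w * (groupCoord I 1 w)ᵀ = M.1 w
    simp [groupCoord])
  mul_smul s t M := Subtype.ext (funext fun w => by
    change groupCoord I (s * t) w * M.1 w * (groupCoord I (s * t) w)ᵀ =
      groupCoord I s w * (groupCoord I t w * M.1 w * (groupCoord I t w)ᵀ) * (groupCoord I s w)ᵀ
    simp [groupCoord, Matrix.transpose_mul, Matrix.mul_assoc])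

/-! ### Observables

`X` is a space of matrix valued functions on `I` (the Geroch group or the phase space) and
`e : X → ℝ → Mat` gives the matrix elements of its points. -/

/-- Matrix valued test functions: smooth, with compact support in the interior of `I`. -/
def IsTest (I : Set ℝ) (φ : ℝ → Mat) : Prop :=
  (∀ i j, ContDiff ℝ ∞ (fun w => φ w i j)) ∧ HasCompactSupport φ ∧ tsupport φ ⊆ interior I

/-- A curve in `X` is smooth if its matrix elements are jointly smooth in the curve parameter
and the spectral parameter. -/
def IsSmoothCurve (I : Set ℝ) {X : Type} (e : X → ℝ → Mat) (c : ℝ → X) : Prop :=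
  ∀ i j, ContDiffOn ℝ ∞ (fun p : ℝ × ℝ => e (c p.1) p.2 i j) (Set.univ ×ˢ I)

/-- `φ` is a functional derivative `δF/δx` of `F` at `x`: it is a test function, and along every
smooth curve `x_t` with `x_0 = x` the derivative of `F (x_t)` at `t = 0` is
`∫ ∑ φ(w)_{ij} (d/dt) x_t(w)_{ij} dw`. -/
def HasFunctionalDeriv (I : Set ℝ) {X : Type} (e : X → ℝ → Mat) (F : X → ℝ) (x : X)
    (φ : ℝ → Mat) : Prop :=
  IsTest I φ ∧ ∀ c : ℝ → X, IsSmoothCurve I e c → c 0 = x →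
    HasDerivAt (fun t => F (c t))
      (∫ w, ∑ i, ∑ j, φ w i j * deriv (fun t => e (c t) w i j) 0) 0

/-- An observable: a functional with a smooth, compactly supported functional derivative at
each point of `X`. -/
def IsObservable (I : Set ℝ) {X : Type} (e : X → ℝ → Mat) (F : X → ℝ) : Prop :=
  ∀ x, ∃ φ, HasFunctionalDeriv I e F x φ

open Classical in
/-- A choice of functional derivative at `x`, and `0` if there is none. (The matrix elements are
subject to `det = 1`, and in `Γ` to symmetry, so that functional derivatives are unique only up to
terms that annihilate the tangent vectors. The brackets below are insensitive to these.) -/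
def functionalDeriv (I : Set ℝ) {X : Type} (e : X → ℝ → Mat) (F : X → ℝ) (x : X) : ℝ → Mat :=
  if h : ∃ φ, HasFunctionalDeriv I e F x φ then h.choose else 0

/-- The matrix elements of `x` smeared with the test function `φ`. -/
def smear {X : Type} (e : X → ℝ → Mat) (φ : ℝ → Mat) (x : X) : ℝ :=
  ∫ w, ∑ i, ∑ j, φ w i j * e x w i j

/-! ### Brackets -/

/-- The value on the test function `f(v, w)` of the principal value distribution
`p.v. 1/(v - w)`, the limit as `ε → 0⁺` of
`1/2 (1/(v - w + iε) + 1/(v - w - iε)) = (v - w) / ((v - w)² + ε²)`. -/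
def pv (f : ℝ → ℝ → ℝ) : ℝ :=
  limUnder (𝓝[>] (0 : ℝ)) fun ε : ℝ =>
    ∫ p : ℝ × ℝ, (p.1 - p.2) / ((p.1 - p.2) ^ 2 + ε ^ 2) * f p.1 p.2

/-- The limit that defines the principal value exists for compactly supported `C¹` functions. -/
theorem exists_tendsto_pv (f : ℝ → ℝ → ℝ) (hf : ContDiff ℝ 1 fun p : ℝ × ℝ => f p.1 p.2)
    (hf' : HasCompactSupport fun p : ℝ × ℝ => f p.1 p.2) :
    ∃ L, Tendsto (fun ε : ℝ =>
      ∫ p : ℝ × ℝ, (p.1 - p.2) / ((p.1 - p.2) ^ 2 + ε ^ 2) * f p.1 p.2) (𝓝[>] 0) (𝓝 L) := by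
  obtain ⟨C, hC⟩ := hf.lipschitzWith_of_hasCompactSupport hf' one_ne_zero
  set g : ℝ × ℝ → ℝ := fun p => f p.1 p.2 with hg
  have hgc : Continuous g := hf.continuous
  set K : Set (ℝ × ℝ) := tsupport g ∪ Prod.swap ⁻¹' tsupport g with hK
  have hKc : IsCompact K := by
    refine hf'.isCompact.union ?_
    have : Prod.swap ⁻¹' tsupport g = Prod.swap '' tsupport g :=
      (Set.image_swap_eq_preimage_swap).symm ▸ rfl
    rw [this]
    exact hf'.isCompact.image continuous_swap
  have hk : ∀ ε : ℝ, 0 < ε → Continuous fun p : ℝ × ℝ => (p.1 - p.2) / ((p.1 - p.2) ^ 2 + ε ^ 2) := by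
    intro ε hε
    refine Continuous.div (by fun_prop) (by fun_prop) fun p => by positivity
  refine ⟨∫ p : ℝ × ℝ, 1 / 2 * (1 / (p.1 - p.2) * (g p - g p.swap)), ?_⟩
  have key : Tendsto (fun ε : ℝ => ∫ p : ℝ × ℝ,
      1 / 2 * ((p.1 - p.2) / ((p.1 - p.2) ^ 2 + ε ^ 2) * (g p - g p.swap))) (𝓝[>] 0)
      (𝓝 (∫ p : ℝ × ℝ, 1 / 2 * (1 / (p.1 - p.2) * (g p - g p.swap)))) := by
    refine tendsto_integral_filter_of_dominated_convergence (K.indicator fun _ => (C : ℝ))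
      ?_ ?_ ?_ ?_
    · filter_upwards [self_mem_nhdsWithin] with ε hε
      have h1 := hk ε hε
      exact (Continuous.mul continuous_const
        (h1.mul (hgc.sub (hgc.comp continuous_swap)))).aestronglyMeasurable
    · filter_upwards [self_mem_nhdsWithin] with ε (hε : 0 < ε)
      refine Eventually.of_forall fun p => ?_
      by_cases hp : p ∈ K
      · rw [Set.indicator_of_mem hp]
        have hd : |g p - g p.swap| ≤ C * |p.1 - p.2| := by
          have := hC.dist_le_mul p p.swap
          rwa [Real.dist_eq, Prod.dist_eq, Prod.fst_swap, Prod.snd_swap, Real.dist_eq, Real.dist_eq,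
            abs_sub_comm p.2 p.1, max_self] at this
        have hpos : 0 < (p.1 - p.2) ^ 2 + ε ^ 2 := by positivity
        rw [Real.norm_eq_abs, abs_mul, abs_mul, abs_of_pos (by norm_num : (0 : ℝ) < 1 / 2),
          abs_div, abs_of_pos hpos]
        have : |p.1 - p.2| / ((p.1 - p.2) ^ 2 + ε ^ 2) * |g p - g p.swap| ≤ C := by
          rw [div_mul_eq_mul_div, div_le_iff₀ hpos]
          calc |p.1 - p.2| * |g p - g p.swap| ≤ |p.1 - p.2| * (C * |p.1 - p.2|) := by gcongr
            _ = C * (p.1 - p.2) ^ 2 := by rw [← sq_abs (p.1 - p.2)]; ring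
            _ ≤ C * ((p.1 - p.2) ^ 2 + ε ^ 2) := by
              gcongr
              nlinarith
        have h0 : 0 ≤ |p.1 - p.2| / ((p.1 - p.2) ^ 2 + ε ^ 2) * |g p - g p.swap| := by positivity
        linarith
      · have h1 : g p = 0 := image_eq_zero_of_notMem_tsupport fun h => hp (Or.inl h)
        have h2 : g p.swap = 0 := image_eq_zero_of_notMem_tsupport fun h => hp (Or.inr h)
        simp [Set.indicator_of_notMem hp, h1, h2]
    · rw [integrable_indicator_iff hKc.measurableSet]
      exact integrableOn_const hKc.measure_lt_top.ne
    · refine Eventually.of_forall fun p => ?_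
      refine Tendsto.const_mul _ (Tendsto.mul_const _ ?_)
      rcases eq_or_ne (p.1 - p.2) 0 with h | h
      · simp [h]
      · have : Tendsto (fun ε : ℝ => (p.1 - p.2) / ((p.1 - p.2) ^ 2 + ε ^ 2)) (𝓝 0)
            (𝓝 ((p.1 - p.2) / ((p.1 - p.2) ^ 2 + 0 ^ 2))) := by
          refine Tendsto.div tendsto_const_nhds
            (Continuous.tendsto (by fun_prop : Continuous fun ε : ℝ => (p.1 - p.2) ^ 2 + ε ^ 2) 0)
            (by positivity)
        have e : (p.1 - p.2) / ((p.1 - p.2) ^ 2 + 0 ^ 2) = 1 / (p.1 - p.2) := by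
          field_simp; simp
        rw [e] at this
        exact this.mono_left nhdsWithin_le_nhds
  refine key.congr' ?_
  filter_upwards [self_mem_nhdsWithin] with ε (hε : 0 < ε)
  have hi : Integrable fun p : ℝ × ℝ => (p.1 - p.2) / ((p.1 - p.2) ^ 2 + ε ^ 2) * g p :=
    ((hk ε hε).mul hgc).integrable_of_hasCompactSupport hf'.mul_left
  have hs : ∫ p : ℝ × ℝ, (p.1 - p.2) / ((p.1 - p.2) ^ 2 + ε ^ 2) * g p.swap =
      -∫ p : ℝ × ℝ, (p.1 - p.2) / ((p.1 - p.2) ^ 2 + ε ^ 2) * g p := by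
    rw [Measure.volume_eq_prod, ← integral_prod_swap, ← integral_neg]
    refine integral_congr_ae (Eventually.of_forall fun p => ?_)
    simp only [Prod.fst_swap, Prod.snd_swap, Prod.swap_swap]
    rw [← neg_sub p.1 p.2, neg_sq]
    ring
  have hi' : Integrable fun p : ℝ × ℝ => (p.1 - p.2) / ((p.1 - p.2) ^ 2 + ε ^ 2) * g p.swap := by
    have := hi.neg.swap
    refine this.congr (Eventually.of_forall fun p => ?_)
    simp only [Function.comp, Pi.neg_apply, Prod.fst_swap, Prod.snd_swap]
    rw [← neg_sub p.1 p.2, neg_sq]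
    ring
  rw [integral_const_mul]
  simp only [mul_sub]
  rw [integral_sub hi hi', hs]
  ring

theorem tendsto_pv (f : ℝ → ℝ → ℝ) (hf : ContDiff ℝ 1 fun p : ℝ × ℝ => f p.1 p.2)
    (hf' : HasCompactSupport fun p : ℝ × ℝ => f p.1 p.2) :
    Tendsto (fun ε : ℝ =>
      ∫ p : ℝ × ℝ, (p.1 - p.2) / ((p.1 - p.2) ^ 2 + ε ^ 2) * f p.1 p.2) (𝓝[>] 0) (𝓝 (pv f)) :=
  tendsto_nhds_limUnder (exists_tendsto_pv f hf hf')

/-- The contraction `∑ φ(v)_{ab} ψ(w)_{cd} K(v, w)_{ab,cd}`, a function of `v` and `w`. -/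
def contract (φ ψ : ℝ → Mat) (K : ℝ → ℝ → Mat₂) (v w : ℝ) : ℝ :=
  ∑ a, ∑ b, ∑ c, ∑ d, φ v a b * ψ w c d * K v w (a, c) (b, d)

/-- The Casimir element `Ω_a^b_c^d = δ_a^d δ_c^b - (1/2) δ_a^b δ_c^d` of `sl₂`. -/
def Ω : Mat₂ := Matrix.of fun p q =>
  (if p.1 = q.2 then 1 else 0) * (if p.2 = q.1 then 1 else 0)
    - 1 / 2 * ((if p.1 = q.1 then 1 else 0) * (if p.2 = q.2 then 1 else 0))

/-- Transposition in the indices of space 1. -/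
def transpose₁ (X : Mat₂) : Mat₂ := Matrix.of fun p q => X (q.1, p.2) (p.1, q.2)

/-- Transposition in the indices of space 2. -/
def transpose₂ (X : Mat₂) : Mat₂ := Matrix.of fun p q => X (p.1, q.2) (q.1, p.2)

/-- A matrix acting on space 1. -/
def in₁ (A : Mat) : Mat₂ := A ⊗ₖ (1 : Mat)

/-- A matrix acting on space 2. -/
def in₂ (A : Mat) : Mat₂ := (1 : Mat) ⊗ₖ A

/-- The coefficient of `p.v. 1/(v - w)` in the bracket `{M¹(v), M²(w)}` on the phase space. -/
def phaseKernel (I : Set ℝ) (M : PhaseSpace I) (v w : ℝ) : Mat₂ :=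
  let M₁ := in₁ (phaseCoord I M v)
  let M₂ := in₂ (phaseCoord I M w)
  Ω * M₁ * M₂ + M₁ * transpose₁ Ω * M₂ + M₂ * transpose₂ Ω * M₁
    + M₁ * M₂ * transpose₁ (transpose₂ Ω)

/-- The Poisson bracket on the phase space,
`{A, B}_Γ = ∬ (δA/δM(v)_{ab}) (δB/δM(w)_{cd}) {M(v)_{ab}, M(w)_{cd}} dv dw`. -/
def phaseBracket (I : Set ℝ) (A B : PhaseSpace I → ℝ) (M : PhaseSpace I) : ℝ :=
  pv (contract (functionalDeriv I (phaseCoord I) A M) (functionalDeriv I (phaseCoord I) B M)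
    (phaseKernel I M))

/-- The commutator `[Ω, s¹(v) s²(w)]`. -/
def sklyaninKernel (I : Set ℝ) (s : Group I) (v w : ℝ) : Mat₂ :=
  let s₁ := in₁ (groupCoord I s v)
  let s₂ := in₂ (groupCoord I s w)
  Ω * (s₁ * s₂) - (s₁ * s₂) * Ω

/-- A bracket on the Geroch group: a skew-symmetric bilinear operation on observables that
satisfies the Leibniz rule and, more generally, the chain rule, i.e. at each point it depends on
the observables only through their functional derivatives there. These are the properties of a
Poisson bracket except for the Jacobi identity, which is not required, so that all Poisson
brackets are included. Only the values of `br` on observables matter. -/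
structure Bracket (I : Set ℝ) where
  br : (Group I → ℝ) → (Group I → ℝ) → Group I → ℝ
  skew : ∀ A B, IsObservable I (groupCoord I) A → IsObservable I (groupCoord I) B →
    ∀ s, br A B s = -br B A s
  add_left : ∀ A A' B, IsObservable I (groupCoord I) A → IsObservable I (groupCoord I) A' →
    IsObservable I (groupCoord I) B → ∀ s, br (A + A') B s = br A B s + br A' B s
  smul_left : ∀ (r : ℝ) A B, IsObservable I (groupCoord I) A →
    IsObservable I (groupCoord I) B → ∀ s, br (r • A) B s = r * br A B s
  leibniz : ∀ A A' B, IsObservable I (groupCoord I) A → IsObservable I (groupCoord I) A' →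
    IsObservable I (groupCoord I) B → ∀ s, br (A * A') B s = A s * br A' B s + A' s * br A B s
  chain : ∀ A A' B, IsObservable I (groupCoord I) A → IsObservable I (groupCoord I) A' →
    IsObservable I (groupCoord I) B → ∀ s φ, HasFunctionalDeriv I (groupCoord I) A s φ →
      HasFunctionalDeriv I (groupCoord I) A' s φ → br A B s = br A' B s

/-- The action `G × Γ → Γ` is a Poisson map: for all observables `A, B` on `Γ`,
`{A, B}_Γ (g ▷ ξ) = {A^G(g, ·), B^G(g, ·)}_Γ (ξ) + {A^G(·, ξ), B^G(·, ξ)}_G (g)`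
with `A^G(g, ξ) = A (g ▷ ξ)`. -/
def Bracket.ActionIsPoisson {I : Set ℝ} (P : Bracket I) : Prop :=
  ∀ A B : PhaseSpace I → ℝ, IsObservable I (phaseCoord I) A → IsObservable I (phaseCoord I) B →
    ∀ (g : Group I) (ξ : PhaseSpace I),
      phaseBracket I A B (g • ξ) =
        phaseBracket I (fun η => A (g • η)) (fun η => B (g • η)) ξ
          + P.br (fun h => A (h • ξ)) (fun h => B (h • ξ)) g

/-- The bracket is the Sklyanin bracket: `{s¹(v), s²(w)}_G = p.v. 1/(v - w) [Ω, s¹(v) s²(w)]`,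
as an identity between distributions in `v` and `w`. -/
def Bracket.IsSklyanin {I : Set ℝ} (P : Bracket I) : Prop :=
  ∀ φ ψ : ℝ → Mat, IsTest I φ → IsTest I ψ → ∀ s : Group I,
    P.br (smear (groupCoord I) φ) (smear (groupCoord I) ψ) s
      = pv (contract φ ψ (sklyaninKernel I s))

end Geroch

end

/-! Contraction with `Ω` turns both brackets into one symmetric bilinear form, `casimirForm`, under
the odd distribution `pv`. On the phase space, observables with derivatives φ and ψ at M enter
through the momenta M(φ + φᵗ) and M(ψ + ψᵗ) (`contract_phaseKernel`). On the group, the Sklyanin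
kernel gives the form on the left momenta sφᵗ, sψᵗ minus the form on the right momenta φᵗs, ψᵗs
(`contract_sklyaninKernel`). Because of det = 1 a functional derivative fixes these momenta only up
to a scalar matrix, and `casimirForm` annihilates scalars, so nothing depends on the choice.

The pullback h ↦ A(h ▷ ξ) has at g a left momentum equal to the momentum of A at g ▷ ξ, and a right
momentum equal to the momentum of η ↦ A(g ▷ η) at ξ. Hence the defect of invariance of the phase
space bracket is exactly the Sklyanin form of the pullbacks (`phaseBracket_smul`). Since a bracket
sees only functional derivatives, a Sklyanin bracket therefore makes the action Poisson.

Conversely, the Poisson property forces a bracket to agree with the Sklyanin form on pairs of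
pullbacks with a common ξ. Their left momenta X are constrained: XM must be symmetric for M = g ▷ ξ.
With constant M one reaches all momenta fE, gF, where f, g are scalar test functions and EM, FM are
symmetric (`Bracket.ActionIsPoisson.agreesOn_covector`). There are two bases of the traceless
matrices such that each element of the first shares a positive definite M with each element of the
second (`exists_bases`). Expanding the two momenta in these bases with test functions as
coefficients leaves finitely many such pairs, so bilinearity finishes without any density argument
(`Bracket.agreesOn_of_basis`). -/

namespace Geroch

/-! ### Smooth matrix valued functions and test functions -/

/-- Entrywise smoothness of a matrix valued function on a subset of a normed space. -/
def EntrySmooth {E : Type*} [NormedAddCommGroup E] [NormedSpace ℝ E] (S : Set E) (m : E → Mat) :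
    Prop :=
  ∀ i j, ContDiffOn ℝ ∞ (fun p => m p i j) S

section EntrySmooth

variable {E : Type*} [NormedAddCommGroup E] [NormedSpace ℝ E] {S : Set E} {m n : E → Mat}

theorem EntrySmooth.mul (hm : EntrySmooth S m) (hn : EntrySmooth S n) :
    EntrySmooth S (fun w => m w * n w) := by
  intro i j
  simp only [Matrix.mul_apply]
  exact ContDiffOn.sum fun k _ => (hm i k).mul (hn k j)

theorem EntrySmooth.add (hm : EntrySmooth S m) (hn : EntrySmooth S n) :
    EntrySmooth S (fun w => m w + n w) := fun i j => (hm i j).add (hn i j)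

theorem EntrySmooth.transpose (hm : EntrySmooth S m) : EntrySmooth S (fun w => (m w)ᵀ) :=
  fun i j => hm j i

theorem EntrySmooth.smul {f : E → ℝ} (hf : ContDiffOn ℝ ∞ f S) (hm : EntrySmooth S m) :
    EntrySmooth S (fun w => f w • m w) := fun i j => hf.mul (hm i j)

theorem EntrySmooth.const (A : Mat) : EntrySmooth S (fun _ => A) :=
  fun _ _ => contDiffOn_const

theorem EntrySmooth.comp_snd {I : Set ℝ} {m : ℝ → Mat} (hm : SmoothOn I m) :
    EntrySmooth (Set.univ ×ˢ I : Set (ℝ × ℝ)) (fun p => m p.2) := fun i j =>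
  (hm i j).comp contDiff_snd.contDiffOn fun _ hp => hp.2

end EntrySmooth

/-- Off its closed support a function is zero near each point. This lets a test function multiply a
factor that is smooth only on `I`. -/
theorem contDiff_of_contDiffAt_tsupport {E : Type*} [NormedAddCommGroup E] [NormedSpace ℝ E]
    {f : E → ℝ} (h : ∀ x ∈ tsupport f, ContDiffAt ℝ ∞ f x) : ContDiff ℝ ∞ f := by
  refine contDiff_iff_contDiffAt.2 fun x => ?_
  by_cases hx : x ∈ tsupport f
  · exact h x hx
  · exact contDiffAt_const.congr_of_eventuallyEq (notMem_tsupport_iff_eventuallyEq.1 hx)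

/-- Scalar test functions: smooth, with compact support in the interior of `I`. -/
def IsScalarTest (I : Set ℝ) (f : ℝ → ℝ) : Prop :=
  ContDiff ℝ ∞ f ∧ HasCompactSupport f ∧ tsupport f ⊆ interior I

section ScalarTest

variable {I : Set ℝ} {f g : ℝ → ℝ}

theorem IsScalarTest.eq_zero (hf : IsScalarTest I f) {w : ℝ} (hw : w ∉ I) : f w = 0 :=
  image_eq_zero_of_notMem_tsupport fun h => hw (interior_subset (hf.2.2 h))

theorem IsScalarTest.mul_contDiffOn (hf : IsScalarTest I f) (hg : ContDiffOn ℝ ∞ g I) :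
    IsScalarTest I (fun w => f w * g w) := by
  have hs : tsupport (fun w => f w * g w) ⊆ tsupport f := tsupport_mul_subset_left
  refine ⟨contDiff_of_contDiffAt_tsupport fun x hx => ?_, hf.2.1.mul_right, hs.trans hf.2.2⟩
  exact hf.1.contDiffAt.mul (hg.contDiffAt (mem_interior_iff_mem_nhds.1 (hf.2.2 (hs hx))))

theorem IsScalarTest.add (hf : IsScalarTest I f) (hg : IsScalarTest I g) :
    IsScalarTest I (fun w => f w + g w) :=
  ⟨hf.1.add hg.1, hf.2.1.add hg.2.1,
    (tsupport_add f g).trans (Set.union_subset hf.2.2 hg.2.2)⟩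

theorem IsScalarTest.zero : IsScalarTest I (fun _ => 0) :=
  ⟨contDiff_const, HasCompactSupport.zero, by
    have : tsupport (fun _ : ℝ => (0 : ℝ)) = ∅ := tsupport_eq_empty_iff.2 rfl
    simp [this]⟩

theorem IsScalarTest.const_mul (hf : IsScalarTest I f) (r : ℝ) :
    IsScalarTest I (fun w => r * f w) := by
  simpa only [mul_comm] using hf.mul_contDiffOn (g := fun _ => r) contDiffOn_const

theorem IsScalarTest.sum {ι : Type*} (s : Finset ι) {f : ι → ℝ → ℝ}
    (hf : ∀ i ∈ s, IsScalarTest I (f i)) : IsScalarTest I (fun w => ∑ i ∈ s, f i w) := by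
  classical
  induction s using Finset.induction_on with
  | empty => simpa using IsScalarTest.zero
  | insert a s ha ih =>
    simp only [Finset.sum_insert ha]
    exact (hf a (by simp)).add (ih fun i hi => hf i (by simp [hi]))

theorem IsScalarTest.contDiffOn (hf : IsScalarTest I f) : ContDiffOn ℝ ∞ f I := hf.1.contDiffOn

end ScalarTest

section Test

variable {I : Set ℝ} {f : ℝ → ℝ} {φ ψ m : ℝ → Mat}

theorem isTest_iff : IsTest I φ ↔ ∀ i j, IsScalarTest I (fun w => φ w i j) := by
  constructor
  · rintro ⟨h1, h2, h3⟩ i j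
    have hs : Function.support (fun w => φ w i j) ⊆ Function.support φ := by
      intro w hw h
      exact hw (by simp [h])
    exact ⟨h1 i j, h2.mono hs, (closure_mono hs).trans h3⟩
  · intro h
    have hs : tsupport φ ⊆ ⋃ i, ⋃ j, tsupport (fun w => φ w i j) := by
      refine closure_minimal (fun w hw => ?_)
        (isClosed_iUnion_of_finite fun i => isClosed_iUnion_of_finite fun j => isClosed_tsupport _)
      by_contra hc
      simp only [Set.mem_iUnion, not_exists] at hc
      exact hw (by
        ext i j
        exact image_eq_zero_of_notMem_tsupport (f := fun w => φ w i j) (hc i j))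
    have hK : IsCompact (⋃ i, ⋃ j, tsupport (fun w => φ w i j)) :=
      isCompact_iUnion fun i => isCompact_iUnion fun j => (h i j).2.1
    exact ⟨fun i j => (h i j).1, hK.of_isClosed_subset (isClosed_tsupport _) hs,
      hs.trans (Set.iUnion_subset fun i => Set.iUnion_subset fun j => (h i j).2.2)⟩

theorem IsTest.entry (hφ : IsTest I φ) (i j : Fin 2) : IsScalarTest I (fun w => φ w i j) :=
  isTest_iff.1 hφ i j

theorem IsTest.eq_zero (hφ : IsTest I φ) {w : ℝ} (hw : w ∉ I) : φ w = 0 := by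
  ext i j
  exact (hφ.entry i j).eq_zero hw

theorem IsTest.add (hφ : IsTest I φ) (hψ : IsTest I ψ) : IsTest I (fun w => φ w + ψ w) :=
  isTest_iff.2 fun i j => (hφ.entry i j).add (hψ.entry i j)

theorem IsTest.const_smul (hφ : IsTest I φ) (r : ℝ) : IsTest I (fun w => r • φ w) :=
  isTest_iff.2 fun i j => (hφ.entry i j).const_mul r

theorem IsTest.transpose (hφ : IsTest I φ) : IsTest I (fun w => (φ w)ᵀ) :=
  isTest_iff.2 fun i j => hφ.entry j i

theorem IsTest.mul_right (hφ : IsTest I φ) (hm : SmoothOn I m) : IsTest I (fun w => φ w * m w) := by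
  refine isTest_iff.2 fun i j => ?_
  simp only [Matrix.mul_apply]
  exact IsScalarTest.sum _ fun k _ => (hφ.entry i k).mul_contDiffOn (hm k j)

theorem IsTest.mul_left (hφ : IsTest I φ) (hm : SmoothOn I m) : IsTest I (fun w => m w * φ w) := by
  simpa using (hφ.transpose.mul_right hm.transpose).transpose

theorem IsScalarTest.smul (hf : IsScalarTest I f) (hm : SmoothOn I m) :
    IsTest I (fun w => f w • m w) :=
  isTest_iff.2 fun i j => hf.mul_contDiffOn (hm i j)

theorem IsTest.trace_mul (hφ : IsTest I φ) (hm : SmoothOn I m) :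
    IsScalarTest I (fun w => trace (m w * φ w)) := by
  simp only [Matrix.trace, Matrix.diag]
  exact IsScalarTest.sum _ fun i _ => (hφ.mul_left hm).entry i i

end Test

/-! ### The principal value on products -/

section PV

variable {f g : ℝ → ℝ → ℝ}

/-- Compactly supported `C¹` functions of two variables. -/
def IsAdmissible (f : ℝ → ℝ → ℝ) : Prop :=
  ContDiff ℝ 1 (fun p : ℝ × ℝ => f p.1 p.2) ∧ HasCompactSupport fun p : ℝ × ℝ => f p.1 p.2

theorem IsAdmissible.integrable (hf : IsAdmissible f) {ε : ℝ} (hε : 0 < ε) :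
    Integrable fun p : ℝ × ℝ => (p.1 - p.2) / ((p.1 - p.2) ^ 2 + ε ^ 2) * f p.1 p.2 := by
  have hk : Continuous fun p : ℝ × ℝ => (p.1 - p.2) / ((p.1 - p.2) ^ 2 + ε ^ 2) :=
    Continuous.div (by fun_prop) (by fun_prop) fun p => by positivity
  exact (hk.mul hf.1.continuous).integrable_of_hasCompactSupport hf.2.mul_left

/-- `pv` is a `limUnder`, hence linear only where the limits exist; admissibility guarantees that
they do. -/
theorem pv_add (hf : IsAdmissible f) (hg : IsAdmissible g) :
    pv (fun v w => f v w + g v w) = pv f + pv g := by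
  refine tendsto_nhds_unique (tendsto_pv _ (hf.1.add hg.1) (hf.2.add hg.2))
    (((tendsto_pv f hf.1 hf.2).add (tendsto_pv g hg.1 hg.2)).congr' ?_)
  filter_upwards [self_mem_nhdsWithin] with ε hε
  rw [← integral_add (hf.integrable hε) (hg.integrable hε)]
  simp only [mul_add]

theorem IsAdmissible.const_mul (hf : IsAdmissible f) (r : ℝ) :
    IsAdmissible (fun v w => r * f v w) :=
  ⟨contDiff_const.mul hf.1, hf.2.mul_left⟩

theorem pv_const_mul (hf : IsAdmissible f) (r : ℝ) :
    pv (fun v w => r * f v w) = r * pv f := by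
  refine tendsto_nhds_unique (tendsto_pv _ (hf.const_mul r).1 (hf.const_mul r).2)
    (((tendsto_pv f hf.1 hf.2).const_mul r).congr fun ε => ?_)
  rw [← integral_const_mul]
  congr 1
  ext p
  ring

theorem pv_sub (hf : IsAdmissible f) (hg : IsAdmissible g) :
    pv (fun v w => f v w - g v w) = pv f - pv g := by
  have := pv_add hf (hg.const_mul (-1))
  rw [pv_const_mul hg] at this
  simpa [sub_eq_add_neg] using this

theorem IsAdmissible.swap (hf : IsAdmissible f) : IsAdmissible (fun v w => f w v) := by
  refine ⟨hf.1.comp (contDiff_snd.prodMk contDiff_fst), ?_⟩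
  exact hf.2.comp_homeomorph (Homeomorph.prodComm ℝ ℝ)

/-- The regularised kernel is odd in v − w. This is the source of the skew symmetry of the Sklyanin
bracket. -/
theorem pv_swap (hf : IsAdmissible f) : pv (fun v w => f w v) = -pv f := by
  refine tendsto_nhds_unique (tendsto_pv _ hf.swap.1 hf.swap.2)
    ((tendsto_pv f hf.1 hf.2).neg.congr fun ε => ?_)
  rw [Measure.volume_eq_prod, ← integral_prod_swap, ← integral_neg]
  refine integral_congr_ae (Eventually.of_forall fun p => ?_)
  simp only [Prod.fst_swap, Prod.snd_swap]
  rw [← neg_sub p.1 p.2, neg_sq]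
  ring

end PV

/-! ### The Casimir form and its principal value -/

/-- The bilinear form `tr (X Y) - (tr X) (tr Y) / 2` on matrices, the contraction of `X ⊗ Y` with
the Casimir element. -/
noncomputable def casimirForm (X Y : Mat) : ℝ := trace (X * Y) - 1 / 2 * (trace X * trace Y)

theorem casimirForm_comm (X Y : Mat) : casimirForm X Y = casimirForm Y X := by
  simp only [casimirForm, Matrix.trace_mul_comm X Y, mul_comm (trace X)]

theorem casimirForm_add_left (X X' Y : Mat) :
    casimirForm (X + X') Y = casimirForm X Y + casimirForm X' Y := by
  simp only [casimirForm, add_mul, Matrix.trace_add]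
  ring

theorem casimirForm_smul_left (r : ℝ) (X Y : Mat) :
    casimirForm (r • X) Y = r * casimirForm X Y := by
  simp only [casimirForm, Matrix.smul_mul, Matrix.trace_smul, smul_eq_mul]
  ring

/-- Scalars lie in the radical, which is what makes the brackets insensitive to the ambiguity of
functional derivatives. -/
theorem casimirForm_one_left (Y : Mat) : casimirForm 1 Y = 0 := by
  simp [casimirForm]

theorem casimirForm_add_scalar_left (c : ℝ) (X Y : Mat) :
    casimirForm (X + c • 1) Y = casimirForm X Y := by
  rw [casimirForm_add_left, casimirForm_smul_left, casimirForm_one_left, mul_zero, add_zero]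

theorem IsAdmissible.casimirForm {I : Set ℝ} {X Y : ℝ → Mat} (hX : IsTest I X) (hY : IsTest I Y) :
    IsAdmissible (fun v w => casimirForm (X v) (Y w)) := by
  constructor
  · have h1 : ∀ i j, ContDiff ℝ 1 (fun p : ℝ × ℝ => X p.1 i j) := fun i j =>
      ((hX.1 i j).of_le (by exact_mod_cast le_top)).comp contDiff_fst
    have h2 : ∀ i j, ContDiff ℝ 1 (fun p : ℝ × ℝ => Y p.2 i j) := fun i j =>
      ((hY.1 i j).of_le (by exact_mod_cast le_top)).comp contDiff_snd
    simp only [Geroch.casimirForm, Matrix.trace_fin_two, Matrix.mul_apply, Fin.sum_univ_two]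
    exact ((((h1 0 0).mul (h2 0 0)).add ((h1 0 1).mul (h2 1 0))).add
      (((h1 1 0).mul (h2 0 1)).add ((h1 1 1).mul (h2 1 1)))).sub
      (contDiff_const.mul (((h1 0 0).add (h1 1 1)).mul ((h2 0 0).add (h2 1 1))))
  · refine HasCompactSupport.intro (hX.2.1.isCompact.prod hY.2.1.isCompact) fun p hp => ?_
    rw [Set.mem_prod, not_and_or] at hp
    rcases hp with hp | hp
    · simp [Geroch.casimirForm, image_eq_zero_of_notMem_tsupport hp]
    · simp [Geroch.casimirForm, image_eq_zero_of_notMem_tsupport hp]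

theorem pv_casimirForm_add_left {I : Set ℝ} {X X' Y : ℝ → Mat} (hX : IsTest I X)
    (hX' : IsTest I X') (hY : IsTest I Y) :
    pv (fun v w => casimirForm (X v + X' v) (Y w)) =
      pv (fun v w => casimirForm (X v) (Y w)) + pv (fun v w => casimirForm (X' v) (Y w)) := by
  simp only [casimirForm_add_left]
  exact pv_add (.casimirForm hX hY) (.casimirForm hX' hY)

theorem pv_casimirForm_smul_left {I : Set ℝ} {X Y : ℝ → Mat} (r : ℝ) (hX : IsTest I X)
    (hY : IsTest I Y) :
    pv (fun v w => casimirForm (r • X v) (Y w)) = r * pv (fun v w => casimirForm (X v) (Y w)) := by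
  simp only [casimirForm_smul_left]
  exact pv_const_mul (.casimirForm hX hY) r

theorem pv_casimirForm_swap {I : Set ℝ} {X Y : ℝ → Mat} (hX : IsTest I X) (hY : IsTest I Y) :
    pv (fun v w => casimirForm (Y v) (X w)) = -pv (fun v w => casimirForm (X v) (Y w)) := by
  rw [← pv_swap (.casimirForm hX hY)]
  simp only [casimirForm_comm]

/-! ### The kernels in terms of the Casimir form -/

/-- `Ω` is the flip of the two tensor factors minus half the identity, so the trace of Ω(X ⊗ Y) is
`casimirForm X Y`. With `Ω` on the left of s ⊗ s the contraction yields X = sφᵗ, with `Ω` on the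
right X = φᵗs. -/
theorem contract_sklyaninKernel (I : Set ℝ) (s : Group I) (φ ψ : ℝ → Mat) (v w : ℝ) :
    contract φ ψ (sklyaninKernel I s) v w =
      casimirForm (groupCoord I s v * (φ v)ᵀ) (groupCoord I s w * (ψ w)ᵀ)
        - casimirForm ((φ v)ᵀ * groupCoord I s v) ((ψ w)ᵀ * groupCoord I s w) := by
  generalize ha : groupCoord I s v = a
  generalize hb : groupCoord I s w = b
  simp only [contract, sklyaninKernel, ha, hb, casimirForm, in₁, in₂, ← Matrix.mul_kronecker_mul,
    Matrix.mul_one, Matrix.one_mul, Matrix.sub_apply, Matrix.mul_apply, Fintype.sum_prod_type,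
    Fin.sum_univ_two, Matrix.kroneckerMap_apply, Ω, Matrix.of_apply, Matrix.trace_fin_two,
    Matrix.transpose_apply, Fin.isValue, reduceIte, zero_ne_one, one_ne_zero]
  ring

/-- Since M is symmetric, undoing a partial transposition of `Ω` replaces φᵗ by φ or ψᵗ by ψ in the
contraction. The four terms of the kernel are the four resulting combinations. -/
theorem contract_phaseKernel (I : Set ℝ) (M : PhaseSpace I) (φ ψ : ℝ → Mat) (v w : ℝ) :
    contract φ ψ (phaseKernel I M) v w =
      casimirForm (phaseCoord I M v * (φ v + (φ v)ᵀ)) (phaseCoord I M w * (ψ w + (ψ w)ᵀ)) := by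
  have ha' : phaseCoord I M v 1 0 = phaseCoord I M v 0 1 := (M.2.2.1 v).1.isHermitian.apply 0 1
  have hb' : phaseCoord I M w 1 0 = phaseCoord I M w 0 1 := (M.2.2.1 w).1.isHermitian.apply 0 1
  generalize ha : phaseCoord I M v = a at ha' ⊢
  generalize hb : phaseCoord I M w = b at hb' ⊢
  simp only [contract, phaseKernel, ha, hb, casimirForm, in₁, in₂, transpose₁, transpose₂,
    Matrix.add_apply, Matrix.mul_apply, Fintype.sum_prod_type,
    Fin.sum_univ_two, Matrix.kroneckerMap_apply, Ω, Matrix.of_apply, Matrix.trace_fin_two,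
    Matrix.transpose_apply, Fin.isValue, reduceIte, zero_ne_one, one_ne_zero, ha', hb',
    Matrix.one_apply_eq, Matrix.one_apply_ne, ne_eq, not_false_eq_true, mul_zero, zero_mul,
    mul_one, one_mul, add_zero, zero_add, sub_zero, zero_sub]
  ring

/-! ### Differentiation along smooth curves -/

section Curves

variable {I : Set ℝ} {X : Type} {e : X → ℝ → Mat} {c : ℝ → X} {φ : ℝ → Mat}

theorem IsSmoothCurve.differentiable (hc : IsSmoothCurve I e c) {w : ℝ} (hw : w ∈ I)
    (i j : Fin 2) : Differentiable ℝ (fun t => e (c t) w i j) := by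
  have h : ContDiffOn ℝ ∞ (fun t : ℝ => e (c t) w i j) Set.univ :=
    (hc i j).comp (f := fun t : ℝ => (t, w)) (contDiff_id.prodMk contDiff_const).contDiffOn
      fun t _ => ⟨Set.mem_univ _, hw⟩
  exact (contDiffOn_univ.1 h).differentiable (by simp)

theorem IsSmoothCurve.hasDerivAt (hc : IsSmoothCurve I e c) {w : ℝ} (hw : w ∈ I)
    (i j : Fin 2) (t : ℝ) :
    HasDerivAt (fun t => e (c t) w i j) (deriv (fun t => e (c t) w i j) t) t :=
  (hc.differentiable hw i j t).hasDerivAt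

/-- The velocity at `t = 0` of a curve. -/
noncomputable def velocity (e : X → ℝ → Mat) (c : ℝ → X) (w : ℝ) : Mat :=
  Matrix.of fun i j => deriv (fun t => e (c t) w i j) 0

theorem IsSmoothCurve.contDiff_smeared (hc : IsSmoothCurve I e c) (hφ : IsTest I φ) :
    ContDiff ℝ ∞ (fun p : ℝ × ℝ => ∑ i, ∑ j, φ p.2 i j * e (c p.1) p.2 i j) := by
  refine ContDiff.sum fun i _ => ContDiff.sum fun j _ => contDiff_of_contDiffAt_tsupport ?_
  intro p hp
  have h1 : p ∈ tsupport (fun p : ℝ × ℝ => φ p.2 i j) := tsupport_mul_subset_left hp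
  have h2 : p.2 ∈ tsupport (fun w => φ w i j) :=
    tsupport_comp_subset_preimage (fun w => φ w i j) continuous_snd h1
  have h3 : p.2 ∈ interior I := (hφ.entry i j).2.2 h2
  refine ((hφ.1 i j).comp contDiff_snd).contDiffAt.mul ((hc i j).contDiffAt ?_)
  exact prod_mem_nhds univ_mem (mem_interior_iff_mem_nhds.1 h3)

theorem IsSmoothCurve.hasDerivAt_smeared (hc : IsSmoothCurve I e c) (hφ : IsTest I φ) (t w : ℝ) :
    HasDerivAt (fun t => ∑ i, ∑ j, φ w i j * e (c t) w i j)
      (∑ i, ∑ j, φ w i j * deriv (fun t => e (c t) w i j) t) t := by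
  by_cases hw : w ∈ I
  · exact HasDerivAt.fun_sum fun i _ => HasDerivAt.fun_sum fun j _ =>
      (hc.hasDerivAt hw i j t).const_mul _
  · simpa [hφ.eq_zero hw] using hasDerivAt_const t (0 : ℝ)

/-- The t-derivative is the Fréchet derivative of the jointly smooth integrand in the direction (1,
0). Joint continuity supplies the bound for differentiating under the integral. -/
theorem IsSmoothCurve.continuous_deriv_smeared (hc : IsSmoothCurve I e c) (hφ : IsTest I φ) :
    Continuous (fun p : ℝ × ℝ => ∑ i, ∑ j, φ p.2 i j * deriv (fun t => e (c t) p.2 i j) p.1) := by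
  have hG := hc.contDiff_smeared hφ
  have h1 : Continuous (fun p : ℝ × ℝ => fderiv ℝ
      (fun p : ℝ × ℝ => ∑ i, ∑ j, φ p.2 i j * e (c p.1) p.2 i j) p (1, 0)) :=
    (hG.continuous_fderiv (by simp)).clm_apply continuous_const
  refine h1.congr fun p => ?_
  have h2 : HasDerivAt (fun t : ℝ => (t, p.2)) ((1 : ℝ), (0 : ℝ)) p.1 :=
    (hasDerivAt_id p.1).prodMk (hasDerivAt_const p.1 p.2)
  have h3 := ((hG.differentiable (by simp) p).hasFDerivAt).comp_hasDerivAt p.1 h2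
  exact h3.unique (hc.hasDerivAt_smeared hφ p.1 p.2)

theorem IsSmoothCurve.integrable_deriv (hc : IsSmoothCurve I e c) (hφ : IsTest I φ) :
    Integrable (fun w => ∑ i, ∑ j, φ w i j * deriv (fun t => e (c t) w i j) 0) := by
  have h1 : Continuous (fun w => ∑ i, ∑ j, φ w i j * deriv (fun t => e (c t) w i j) 0) :=
    (hc.continuous_deriv_smeared hφ).comp (Continuous.prodMk_right (0 : ℝ))
  refine h1.integrable_of_hasCompactSupport (HasCompactSupport.intro hφ.2.1.isCompact ?_)
  intro w hw
  simp [image_eq_zero_of_notMem_tsupport hw]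

/-- Smeared matrix elements are observables; their functional derivative is the smearing
function. -/
theorem hasFunctionalDeriv_smear (hφ : IsTest I φ) (x : X) :
    HasFunctionalDeriv I e (smear e φ) x φ := by
  refine ⟨hφ, fun c hc _ => ?_⟩
  have hK : IsCompact (Set.Icc (-1 : ℝ) 1 ×ˢ tsupport φ) := isCompact_Icc.prod hφ.2.1.isCompact
  obtain ⟨C, hC⟩ := hK.exists_bound_of_continuousOn (hc.continuous_deriv_smeared hφ).continuousOn
  have hcont : ∀ t, Continuous (fun w => ∑ i, ∑ j, φ w i j * e (c t) w i j) := fun t =>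
    (hc.contDiff_smeared hφ).continuous.comp (Continuous.prodMk_right t)
  refine (hasDerivAt_integral_of_dominated_loc_of_deriv_le
    (F := fun t w => ∑ i, ∑ j, φ w i j * e (c t) w i j)
    (F' := fun t w => ∑ i, ∑ j, φ w i j * deriv (fun t => e (c t) w i j) t)
    (bound := (tsupport φ).indicator fun _ => C) (Icc_mem_nhds (by norm_num) (by norm_num) :
      Set.Icc (-1 : ℝ) 1 ∈ 𝓝 0) ?_ ?_ ?_ ?_ ?_ ?_).2
  · exact Eventually.of_forall fun t => (hcont t).aestronglyMeasurable
  · refine (hcont 0).integrable_of_hasCompactSupport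
      (HasCompactSupport.intro hφ.2.1.isCompact fun w hw => ?_)
    simp [image_eq_zero_of_notMem_tsupport hw]
  · exact (hc.integrable_deriv hφ).aestronglyMeasurable
  · refine Eventually.of_forall fun w t ht => ?_
    by_cases hw : w ∈ tsupport φ
    · simpa [Set.indicator_of_mem hw] using hC (t, w) ⟨ht, hw⟩
    · simp [Set.indicator_of_notMem hw, image_eq_zero_of_notMem_tsupport hw]
  · rw [integrable_indicator_iff hφ.2.1.isCompact.measurableSet]
    exact integrableOn_const hφ.2.1.isCompact.measure_lt_top.ne
  · exact Eventually.of_forall fun w t _ => hc.hasDerivAt_smeared hφ t w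

theorem isObservable_smear (hφ : IsTest I φ) : IsObservable I e (smear e φ) :=
  fun x => ⟨φ, hasFunctionalDeriv_smear hφ x⟩

end Curves

/-! ### Calculus of functional derivatives -/

section Calculus

variable {I : Set ℝ} {X : Type} {e : X → ℝ → Mat} {A B : X → ℝ} {x : X} {φ ψ : ℝ → Mat}

theorem HasFunctionalDeriv.add (hA : HasFunctionalDeriv I e A x φ)
    (hB : HasFunctionalDeriv I e B x ψ) :
    HasFunctionalDeriv I e (A + B) x (fun w => φ w + ψ w) := by
  refine ⟨hA.1.add hB.1, fun c hc h0 => ?_⟩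
  refine ((hA.2 c hc h0).add (hB.2 c hc h0)).congr_deriv ?_
  rw [← integral_add (hc.integrable_deriv hA.1) (hc.integrable_deriv hB.1)]
  simp only [Matrix.add_apply, add_mul, Finset.sum_add_distrib]

theorem HasFunctionalDeriv.const_smul (hA : HasFunctionalDeriv I e A x φ) (r : ℝ) :
    HasFunctionalDeriv I e (r • A) x (fun w => r • φ w) := by
  refine ⟨hA.1.const_smul r, fun c hc h0 => ?_⟩
  refine ((hA.2 c hc h0).const_mul r).congr_deriv ?_
  rw [← integral_const_mul]
  simp only [Matrix.smul_apply, smul_eq_mul, Finset.mul_sum, mul_assoc]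

theorem HasFunctionalDeriv.mul (hA : HasFunctionalDeriv I e A x φ)
    (hB : HasFunctionalDeriv I e B x ψ) :
    HasFunctionalDeriv I e (A * B) x (fun w => A x • ψ w + B x • φ w) := by
  refine ⟨(hB.const_smul _).1.add (hA.const_smul _).1, fun c hc h0 => ?_⟩
  -- The integral is not computed: it is also the derivative along the curve of the combination of
  -- `A` and `B` with coefficients frozen at `x`, and derivatives are unique.
  have h1 := ((hB.const_smul (A x)).add (hA.const_smul (B x))).2 c hc h0
  refine ((hA.2 c hc h0).mul (hB.2 c hc h0)).congr_deriv ?_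
  rw [← h1.deriv, h0, add_comm]
  have h2 := ((hB.2 c hc h0).const_mul (A x)).add ((hA.2 c hc h0).const_mul (B x))
  rw [mul_comm _ (B x)]
  exact h2.deriv.symm

theorem HasFunctionalDeriv.functionalDeriv (hA : HasFunctionalDeriv I e A x φ) :
    HasFunctionalDeriv I e A x (functionalDeriv I e A x) := by
  have h : ∃ φ, HasFunctionalDeriv I e A x φ := ⟨φ, hA⟩
  rw [Geroch.functionalDeriv, dif_pos h]
  exact h.choose_spec

theorem IsObservable.hasFunctionalDeriv (hA : IsObservable I e A) (x : X) :
    HasFunctionalDeriv I e A x (Geroch.functionalDeriv I e A x) :=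
  (hA x).choose_spec.functionalDeriv

theorem IsObservable.add (hA : IsObservable I e A) (hB : IsObservable I e B) :
    IsObservable I e (A + B) :=
  fun x => ⟨_, (hA.hasFunctionalDeriv x).add (hB.hasFunctionalDeriv x)⟩

/-- Pullback of functional derivatives along a map of function spaces. -/
theorem HasFunctionalDeriv.pullback {Y : Type} {e' : Y → ℝ → Mat} (T : Y → X) {y : Y}
    (hA : HasFunctionalDeriv I e A (T y) φ) (hψ : IsTest I ψ)
    (hT : ∀ c, IsSmoothCurve I e' c → c 0 = y → IsSmoothCurve I e (fun t => T (c t)) ∧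
      ∀ w ∈ I, trace ((φ w)ᵀ * velocity e (fun t => T (c t)) w) =
        trace ((ψ w)ᵀ * velocity e' c w)) :
    HasFunctionalDeriv I e' (fun y => A (T y)) y ψ := by
  refine ⟨hψ, fun c hc h0 => ?_⟩
  obtain ⟨h1, h2⟩ := hT c hc h0
  refine (hA.2 _ h1 (by rw [h0])).congr_deriv (integral_congr_ae (Eventually.of_forall fun w => ?_))
  by_cases hw : w ∈ I
  · have h3 := h2 w hw
    simp only [Matrix.trace_fin_two, Matrix.mul_apply, Fin.sum_univ_two, Matrix.transpose_apply,
      velocity, Matrix.of_apply] at h3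
    simp only [Fin.sum_univ_two]
    linear_combination h3
  · simp [hA.1.eq_zero hw, hψ.eq_zero hw]

end Calculus

/-! ### Derivatives of matrix valued functions of a real variable -/

/-- Entrywise derivative at `0`. -/
def HasEntryDeriv (m : ℝ → Mat) (m' : Mat) : Prop :=
  ∀ i j, HasDerivAt (fun t => m t i j) (m' i j) 0

theorem HasEntryDeriv.mul {m n : ℝ → Mat} {m' n' : Mat} (hm : HasEntryDeriv m m')
    (hn : HasEntryDeriv n n') : HasEntryDeriv (fun t => m t * n t) (m' * n 0 + m 0 * n') := by
  intro i j
  simp only [Matrix.mul_apply, Matrix.add_apply, ← Finset.sum_add_distrib]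
  exact HasDerivAt.fun_sum fun k _ => (hm i k).mul (hn k j)

theorem HasEntryDeriv.transpose {m : ℝ → Mat} {m' : Mat} (hm : HasEntryDeriv m m') :
    HasEntryDeriv (fun t => (m t)ᵀ) m'ᵀ := fun i j => hm j i

theorem HasEntryDeriv.const (A : Mat) : HasEntryDeriv (fun _ => A) 0 :=
  fun _ _ => hasDerivAt_const _ _

theorem HasEntryDeriv.velocity_eq {X : Type} {e : X → ℝ → Mat} {c : ℝ → X} {w : ℝ} {m' : Mat}
    (h : HasEntryDeriv (fun t => e (c t) w) m') : velocity e c w = m' := by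
  ext i j
  exact (h i j).deriv

theorem IsSmoothCurve.hasEntryDeriv {I : Set ℝ} {X : Type} {e : X → ℝ → Mat} {c : ℝ → X}
    (hc : IsSmoothCurve I e c) {w : ℝ} (hw : w ∈ I) :
    HasEntryDeriv (fun t => e (c t) w) (velocity e c w) := fun i j => hc.hasDerivAt hw i j 0

/-! ### Points of the group and of the phase space -/

section Points

variable {I : Set ℝ}

theorem smoothOn_groupCoord (s : Group I) : SmoothOn I (groupCoord I s) := s.2.1

theorem smoothOn_phaseCoord (M : PhaseSpace I) : SmoothOn I (phaseCoord I M) := M.2.1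

theorem phaseCoord_transpose (M : PhaseSpace I) (w : ℝ) :
    (phaseCoord I M w)ᵀ = phaseCoord I M w := by
  ext i j
  exact (M.2.2.1 w).1.isHermitian.apply i j

theorem groupCoord_det (s : Group I) (w : ℝ) : (groupCoord I s w).det = 1 :=
  ((s : ℝ → SL(2, ℝ)) w).2

theorem adjugate_mul_groupCoord (s : Group I) (w : ℝ) :
    (groupCoord I s w).adjugate * groupCoord I s w = 1 := by
  rw [Matrix.adjugate_mul, groupCoord_det, one_smul]

theorem groupCoord_mul_adjugate (s : Group I) (w : ℝ) :
    groupCoord I s w * (groupCoord I s w).adjugate = 1 := by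
  rw [Matrix.mul_adjugate, groupCoord_det, one_smul]

theorem phaseCoord_smul (s : Group I) (M : PhaseSpace I) (w : ℝ) :
    phaseCoord I (s • M) w = groupCoord I s w * phaseCoord I M w * (groupCoord I s w)ᵀ := rfl

end Points

/-! ### Pullbacks along the action -/

section Action

variable {I : Set ℝ} {A : PhaseSpace I → ℝ} {φ : ℝ → Mat}

theorem HasFunctionalDeriv.smul_left (g : Group I) (ξ : PhaseSpace I)
    (hA : HasFunctionalDeriv I (phaseCoord I) A (g • ξ) φ) :
    HasFunctionalDeriv I (phaseCoord I) (fun η => A (g • η)) ξ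
      (fun w => (groupCoord I g w)ᵀ * φ w * groupCoord I g w) := by
  have hg := smoothOn_groupCoord g
  refine hA.pullback (fun η => g • η) ((hA.1.mul_left hg.transpose).mul_right hg) fun c hc h0 =>
    ⟨((EntrySmooth.comp_snd hg).mul hc).mul (EntrySmooth.comp_snd hg).transpose, fun w hw => ?_⟩
  have h1 := ((HasEntryDeriv.const (groupCoord I g w)).mul (hc.hasEntryDeriv hw)).mul
    (HasEntryDeriv.const (groupCoord I g w)ᵀ)
  rw [HasEntryDeriv.velocity_eq (e := phaseCoord I) (c := fun t => g • c t) h1]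
  generalize velocity (phaseCoord I) c w = u
  generalize groupCoord I g w = a
  generalize φ w = p
  simp only [zero_mul, zero_add, mul_zero, add_zero, Matrix.transpose_mul,
    Matrix.transpose_transpose]
  rw [← Matrix.mul_assoc, Matrix.trace_mul_comm]
  simp only [Matrix.mul_assoc]

/-- A velocity u of h at g moves hξhᵗ by uξgᵗ + gξuᵗ. These terms are transposes of each other
because ξ is symmetric, so only φ + φᵗ is seen. -/
theorem HasFunctionalDeriv.smul_right (g : Group I) (ξ : PhaseSpace I)
    (hA : HasFunctionalDeriv I (phaseCoord I) A (g • ξ) φ) :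
    HasFunctionalDeriv I (groupCoord I) (fun h => A (h • ξ)) g
      (fun w => (φ w + (φ w)ᵀ) * (groupCoord I g w * phaseCoord I ξ w)) := by
  have hξ := smoothOn_phaseCoord ξ
  refine hA.pullback (fun h => h • ξ) ((hA.1.add hA.1.transpose).mul_right
    ((smoothOn_groupCoord g).mul hξ)) fun c hc h0 =>
    ⟨(EntrySmooth.mul hc (EntrySmooth.comp_snd hξ)).mul (EntrySmooth.transpose hc),
      fun w hw => ?_⟩
  have h1 := ((hc.hasEntryDeriv hw).mul (HasEntryDeriv.const (phaseCoord I ξ w))).mul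
    (hc.hasEntryDeriv hw).transpose
  rw [HasEntryDeriv.velocity_eq (e := phaseCoord I) (c := fun t => c t • ξ) h1, h0]
  have hs := phaseCoord_transpose ξ w
  generalize velocity (groupCoord I) c w = u
  generalize groupCoord I g w = a
  generalize φ w = p
  generalize phaseCoord I ξ w = M at hs ⊢
  have h10 : M 1 0 = M 0 1 := congrFun (congrFun hs 0) 1
  simp only [Matrix.trace_fin_two, Matrix.mul_apply, Fin.sum_univ_two, Matrix.transpose_apply,
    Matrix.add_apply, Matrix.zero_apply, h10]
  ring

end Action

/-! ### Unipotent curves and the uniqueness of functional derivatives -/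

section Uniqueness

variable {I : Set ℝ}

/-- The curve `1 + t k(w) N` in the Geroch group, for `N` nilpotent and a test function `k`. -/
def unipotentCurve (N : Mat) (hN : N.trace = 0) (hN' : N.det = 0) (k : ℝ → ℝ)
    (hk : IsScalarTest I k) (t : ℝ) : Group I :=
  ⟨fun w => ⟨1 + (t * k w) • N, by
      rw [Matrix.trace_fin_two] at hN
      rw [Matrix.det_fin_two] at hN' ⊢
      simp only [Matrix.add_apply, Matrix.smul_apply, smul_eq_mul, Matrix.one_apply_eq,
        Matrix.one_apply_ne, ne_eq, zero_ne_one, one_ne_zero, not_false_eq_true]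
      linear_combination (t * k w) * hN + (t * k w) ^ 2 * hN'⟩,
    (EntrySmooth.const 1).add ((EntrySmooth.const N).smul (contDiffOn_const.mul hk.contDiffOn)),
    fun w hw => by
      ext i j
      simp [hk.eq_zero hw]⟩

variable {N : Mat} {hN : N.trace = 0} {hN' : N.det = 0} {k : ℝ → ℝ} {hk : IsScalarTest I k}

theorem groupCoord_unipotentCurve (t w : ℝ) :
    groupCoord I (unipotentCurve N hN hN' k hk t) w = 1 + (t * k w) • N := rfl

theorem unipotentCurve_zero : unipotentCurve N hN hN' k hk 0 = 1 := by
  refine Subtype.ext (funext fun w => Subtype.ext ?_)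
  change 1 + (0 * k w) • N = 1
  simp

theorem isSmoothCurve_unipotentCurve :
    IsSmoothCurve I (groupCoord I) (unipotentCurve N hN hN' k hk) :=
  (EntrySmooth.const 1).add ((EntrySmooth.const N).smul
    (contDiff_fst.mul (hk.1.comp contDiff_snd)).contDiffOn)

theorem hasEntryDeriv_unipotentCurve (w : ℝ) :
    HasEntryDeriv (fun t => groupCoord I (unipotentCurve N hN hN' k hk t) w) (k w • N) := by
  intro i j
  change HasDerivAt (fun t => (1 : Mat) i j + (t * k w) * N i j) (k w * N i j) 0
  simpa using (((hasDerivAt_id (0 : ℝ)).mul_const (k w)).mul_const (N i j)).const_add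
    ((1 : Mat) i j)

/-- A test function with `∫ k² = 0` vanishes. -/
theorem IsScalarTest.eq_zero_of_integral_sq (hk : IsScalarTest I k) (h : ∫ w, k w * k w = 0)
    (w : ℝ) : k w = 0 := by
  have hc : Continuous (fun w => k w * k w) := hk.1.continuous.mul hk.1.continuous
  have h1 := (integral_eq_zero_iff_of_nonneg (fun w => mul_self_nonneg (k w))
    (hc.integrable_of_hasCompactSupport hk.2.1.mul_right)).1 h
  have h2 := (hc.ae_eq_iff_eq volume continuous_const).1 h1
  exact mul_self_eq_zero.1 (congrFun h2 w)

/-- Nilpotent matrices span the traceless ones, whose orthogonal complement for the trace form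
consists of the scalars. Nilpotents are used because 1 + tN then has determinant 1 for all t. -/
theorem exists_eq_smul_one (X : Mat)
    (h : ∀ N : Mat, N.trace = 0 → N.det = 0 → trace (N * X) = 0) : ∃ c : ℝ, X = c • 1 := by
  have h1 := h !![0, 1; 0, 0] (by simp [Matrix.trace_fin_two]) (by simp)
  have h2 := h !![0, 0; 1, 0] (by simp [Matrix.trace_fin_two]) (by simp)
  have h3 := h !![1, -1; 1, -1] (by simp [Matrix.trace_fin_two]) (by simp)
  simp only [Matrix.trace_fin_two, Matrix.mul_apply, Fin.sum_univ_two, Matrix.of_apply,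
    Matrix.cons_val', Matrix.cons_val_zero, Matrix.cons_val_one, Matrix.cons_val_fin_one] at h1 h2 h3
  refine ⟨X 0 0, ?_⟩
  ext i j
  fin_cases i <;> fin_cases j <;> simp
  · linear_combination h2
  · linear_combination h1
  · linear_combination -h3 + h2 - h1

/-- Vary s by a unipotent curve whose profile k is the pairing of N with the momentum sδᵗ itself.
The derivative of the zero functional then equals ∫ k², so k vanishes for every nilpotent N. -/
theorem HasFunctionalDeriv.exists_scalar_of_zero_group {s : Group I} {δ : ℝ → Mat}
    (h : HasFunctionalDeriv I (groupCoord I) (fun _ => 0) s δ) (w : ℝ) :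
    ∃ c : ℝ, groupCoord I s w * (δ w)ᵀ = c • 1 := by
  refine exists_eq_smul_one _ fun N hN hN' => ?_
  have hk : IsScalarTest I fun w => trace (N * (groupCoord I s w * (δ w)ᵀ)) := by
    simpa only [Matrix.mul_assoc] using
      h.1.transpose.trace_mul (SmoothOn.mul (EntrySmooth.const N) (smoothOn_groupCoord s))
  set c : ℝ → Group I := fun t => unipotentCurve N hN hN' _ hk t * s with hc
  have h1 : IsSmoothCurve I (groupCoord I) c :=
    EntrySmooth.mul isSmoothCurve_unipotentCurve (EntrySmooth.comp_snd (smoothOn_groupCoord s))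
  have h2 := h.2 c h1 (by rw [hc]; simp only [unipotentCurve_zero, one_mul])
  have h3 := h2.unique (hasDerivAt_const 0 0)
  refine hk.eq_zero_of_integral_sq (h3 ▸ integral_congr_ae (Eventually.of_forall fun w => ?_)) w
  have h4 : velocity (groupCoord I) c w =
      (trace (N * (groupCoord I s w * (δ w)ᵀ)) • N) * groupCoord I s w + _ * 0 :=
    HasEntryDeriv.velocity_eq ((hasEntryDeriv_unipotentCurve (hk := hk) w).mul (HasEntryDeriv.const (groupCoord I s w)))
  have h5 : ∀ i j, deriv (fun t => groupCoord I (c t) w i j) 0 = velocity (groupCoord I) c w i j :=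
    fun _ _ => rfl
  simp only [h5, h4]
  generalize hx : trace (N * (groupCoord I s w * (δ w)ᵀ)) = x
  simp only [Matrix.trace_fin_two, Matrix.mul_apply, Fin.sum_univ_two, Matrix.transpose_apply,
    Matrix.add_apply, Matrix.smul_apply, Matrix.zero_apply, smul_eq_mul] at hx ⊢
  linear_combination (-x) * hx

/-- The same variation, now carried to the phase space by the action; its velocity k(NM + MNᵗ) pairs
with δ to k tr(N M(δ + δᵗ)) = k². -/
theorem HasFunctionalDeriv.exists_scalar_of_zero_phase {M : PhaseSpace I} {δ : ℝ → Mat}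
    (h : HasFunctionalDeriv I (phaseCoord I) (fun _ => 0) M δ) (w : ℝ) :
    ∃ c : ℝ, phaseCoord I M w * (δ w + (δ w)ᵀ) = c • 1 := by
  refine exists_eq_smul_one _ fun N hN hN' => ?_
  have hk : IsScalarTest I fun w => trace (N * (phaseCoord I M w * (δ w + (δ w)ᵀ))) := by
    simpa only [Matrix.mul_assoc] using
      (h.1.add h.1.transpose).trace_mul (SmoothOn.mul (EntrySmooth.const N) (smoothOn_phaseCoord M))
  set u : ℝ → Group I := unipotentCurve N hN hN' _ hk with hu
  set c : ℝ → PhaseSpace I := fun t => u t • M with hc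
  have h0 : IsSmoothCurve I (groupCoord I) u := isSmoothCurve_unipotentCurve
  have h1 : IsSmoothCurve I (phaseCoord I) c :=
    (EntrySmooth.mul h0 (EntrySmooth.comp_snd (smoothOn_phaseCoord M))).mul
      (EntrySmooth.transpose h0)
  have h2 := h.2 c h1 (by rw [hc, hu]; simp only [unipotentCurve_zero, one_smul])
  have h3 := h2.unique (hasDerivAt_const 0 0)
  refine hk.eq_zero_of_integral_sq (h3 ▸ integral_congr_ae (Eventually.of_forall fun w => ?_)) w
  have hd := hasEntryDeriv_unipotentCurve (hN := hN) (hN' := hN') (hk := hk) w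
  have h4 := HasEntryDeriv.velocity_eq (e := phaseCoord I) (c := c)
    ((hd.mul (HasEntryDeriv.const (phaseCoord I M w))).mul hd.transpose)
  have h5 : ∀ i j, deriv (fun t => phaseCoord I (c t) w i j) 0 = velocity (phaseCoord I) c w i j :=
    fun _ _ => rfl
  have h10 : phaseCoord I M w 1 0 = phaseCoord I M w 0 1 :=
    congrFun (congrFun (phaseCoord_transpose M w) 0) 1
  have hu0 : groupCoord I (u 0) w = 1 := by
    rw [hu, unipotentCurve_zero]
    rfl
  simp only [h5, h4, groupCoord_unipotentCurve, hu0]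
  generalize hx : trace (N * (phaseCoord I M w * (δ w + (δ w)ᵀ))) = x
  simp only [Matrix.trace_fin_two, Matrix.mul_apply, Fin.sum_univ_two, Matrix.transpose_apply,
    Matrix.add_apply, Matrix.smul_apply, Matrix.zero_apply, smul_eq_mul, zero_mul, add_zero,
    Matrix.one_apply_eq, Matrix.one_apply_ne, ne_eq, zero_ne_one, one_ne_zero, not_false_eq_true,
    h10] at hx ⊢
  linear_combination (-x) * hx

theorem HasFunctionalDeriv.sub_self {X : Type} {e : X → ℝ → Mat} {A : X → ℝ} {x : X}
    {φ ψ : ℝ → Mat} (hφ : HasFunctionalDeriv I e A x φ) (hψ : HasFunctionalDeriv I e A x ψ) :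
    HasFunctionalDeriv I e (fun _ => 0) x (fun w => φ w + (-1 : ℝ) • ψ w) := by
  have h := hφ.add (hψ.const_smul (-1))
  have h0 : A + (-1 : ℝ) • A = fun _ => 0 := by
    ext y
    simp
  rwa [h0] at h

theorem HasFunctionalDeriv.group_unique {A : Group I → ℝ} {s : Group I} {φ ψ : ℝ → Mat}
    (hφ : HasFunctionalDeriv I (groupCoord I) A s φ)
    (hψ : HasFunctionalDeriv I (groupCoord I) A s ψ) (w : ℝ) :
    ∃ c : ℝ, groupCoord I s w * (φ w)ᵀ = groupCoord I s w * (ψ w)ᵀ + c • 1 := by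
  obtain ⟨c, hc⟩ := (hφ.sub_self hψ).exists_scalar_of_zero_group w
  refine ⟨c, ?_⟩
  rw [← hc, ← Matrix.mul_add]
  simp

theorem HasFunctionalDeriv.phase_unique {A : PhaseSpace I → ℝ} {M : PhaseSpace I} {φ ψ : ℝ → Mat}
    (hφ : HasFunctionalDeriv I (phaseCoord I) A M φ)
    (hψ : HasFunctionalDeriv I (phaseCoord I) A M ψ) (w : ℝ) :
    ∃ c : ℝ, phaseCoord I M w * (φ w + (φ w)ᵀ) = phaseCoord I M w * (ψ w + (ψ w)ᵀ) + c • 1 := by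
  obtain ⟨c, hc⟩ := (hφ.sub_self hψ).exists_scalar_of_zero_phase w
  refine ⟨c, ?_⟩
  rw [← hc, ← Matrix.mul_add]
  congr 1
  simp only [Matrix.transpose_add, Matrix.transpose_smul]
  module

/-- Functional derivatives on the group are determined up to multiples of `s⁻ᵗ`, which annihilate
the tangent vectors because `det s = 1`. -/
theorem HasFunctionalDeriv.group_congr {A : Group I → ℝ} {s : Group I} {φ ψ : ℝ → Mat}
    (hφ : HasFunctionalDeriv I (groupCoord I) A s φ) (hψ : IsTest I ψ)
    (h : ∀ w, ∃ c : ℝ, groupCoord I s w * (φ w)ᵀ = groupCoord I s w * (ψ w)ᵀ + c • 1) :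
    HasFunctionalDeriv I (groupCoord I) A s ψ := by
  refine HasFunctionalDeriv.pullback (fun s => s) hφ hψ fun c hc h0 => ⟨hc, fun w hw => ?_⟩
  obtain ⟨r, hr⟩ := h w
  have h1 : (φ w)ᵀ = (ψ w)ᵀ + r • (groupCoord I s w).adjugate := by
    have := congrArg (fun X => (groupCoord I s w).adjugate * X) hr
    simpa [← Matrix.mul_assoc, adjugate_mul_groupCoord, Matrix.mul_add] using this
  -- This trace is the derivative of the determinant, which is constantly 1 along the curve.
  have h2 : trace ((groupCoord I s w).adjugate * velocity (groupCoord I) c w) = 0 := by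
    have hd := hc.hasEntryDeriv hw
    have h3 := ((hd 0 0).mul (hd 1 1)).sub ((hd 0 1).mul (hd 1 0))
    have h4 : (fun t => groupCoord I (c t) w 0 0 * groupCoord I (c t) w 1 1
        - groupCoord I (c t) w 0 1 * groupCoord I (c t) w 1 0) = fun _ => 1 := by
      ext t
      rw [← Matrix.det_fin_two, groupCoord_det]
    have h5 := h3.unique ((hasDerivAt_const (0 : ℝ) (1 : ℝ)).congr_of_eventuallyEq
      (Eventually.of_forall (congrFun h4)))
    simp only [h0] at h5
    simp only [Matrix.trace_fin_two, Matrix.adjugate_fin_two, Matrix.mul_apply, Fin.sum_univ_two,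
      Matrix.of_apply, Matrix.cons_val', Matrix.cons_val_zero, Matrix.cons_val_one,
      Matrix.cons_val_fin_one]
    linear_combination h5
  rw [h1, Matrix.add_mul, Matrix.trace_add, Matrix.smul_mul, Matrix.trace_smul, h2]
  simp

end Uniqueness

section Brackets

variable {I : Set ℝ}

/-! ### The phase space bracket -/

/-- Frees the bracket from the arbitrary choice in `functionalDeriv`: another choice shifts the
momenta by scalars, which the form annihilates. -/
theorem phaseBracket_eq {A B : PhaseSpace I → ℝ} {M : PhaseSpace I} {φ ψ : ℝ → Mat}
    (hA : HasFunctionalDeriv I (phaseCoord I) A M φ)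
    (hB : HasFunctionalDeriv I (phaseCoord I) B M ψ) :
    phaseBracket I A B M = pv fun v w =>
      casimirForm (phaseCoord I M v * (φ v + (φ v)ᵀ)) (phaseCoord I M w * (ψ w + (ψ w)ᵀ)) := by
  rw [phaseBracket]
  congr 1
  funext v w
  obtain ⟨a, ha⟩ := hA.functionalDeriv.phase_unique hA v
  obtain ⟨b, hb⟩ := hB.functionalDeriv.phase_unique hB w
  rw [contract_phaseKernel, ha, hb, casimirForm_add_scalar_left, casimirForm_comm,
    casimirForm_add_scalar_left, casimirForm_comm]

/-! ### The Sklyanin bracket -/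

/-- The Sklyanin bracket as a form on functional derivatives. -/
noncomputable def sklyaninForm (s : Group I) (φ ψ : ℝ → Mat) : ℝ :=
  pv (contract φ ψ (sklyaninKernel I s))

/-- Two matrix functions that define the same linear form on the tangent space of the Geroch
group at `s`. -/
def SameCovector (s : Group I) (φ ψ : ℝ → Mat) : Prop :=
  ∀ w, ∃ c : ℝ, groupCoord I s w * (φ w)ᵀ = groupCoord I s w * (ψ w)ᵀ + c • 1

theorem SameCovector.symm {s : Group I} {φ ψ : ℝ → Mat} (h : SameCovector s φ ψ) :
    SameCovector s ψ φ := fun w => by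
  obtain ⟨c, hc⟩ := h w
  exact ⟨-c, by rw [hc]; module⟩

theorem sklyaninForm_eq (s : Group I) {φ ψ : ℝ → Mat} (hφ : IsTest I φ) (hψ : IsTest I ψ) :
    sklyaninForm s φ ψ =
      pv (fun v w => casimirForm (groupCoord I s v * (φ v)ᵀ) (groupCoord I s w * (ψ w)ᵀ)) -
      pv (fun v w => casimirForm ((φ v)ᵀ * groupCoord I s v) ((ψ w)ᵀ * groupCoord I s w)) := by
  have hs := smoothOn_groupCoord s
  rw [sklyaninForm, ← pv_sub (.casimirForm (hφ.transpose.mul_left hs) (hψ.transpose.mul_left hs))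
    (.casimirForm (hφ.transpose.mul_right hs) (hψ.transpose.mul_right hs))]
  congr 1
  funext v w
  exact contract_sklyaninKernel I s φ ψ v w

theorem sklyaninForm_swap (s : Group I) {φ ψ : ℝ → Mat} (hφ : IsTest I φ) (hψ : IsTest I ψ) :
    sklyaninForm s ψ φ = -sklyaninForm s φ ψ := by
  have hs := smoothOn_groupCoord s
  rw [sklyaninForm_eq s hφ hψ, sklyaninForm_eq s hψ hφ,
    pv_casimirForm_swap (hφ.transpose.mul_left hs) (hψ.transpose.mul_left hs),
    pv_casimirForm_swap (hφ.transpose.mul_right hs) (hψ.transpose.mul_right hs)]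
  ring

theorem sklyaninForm_add_left (s : Group I) {φ φ' ψ : ℝ → Mat} (hφ : IsTest I φ)
    (hφ' : IsTest I φ') (hψ : IsTest I ψ) :
    sklyaninForm s (fun w => φ w + φ' w) ψ = sklyaninForm s φ ψ + sklyaninForm s φ' ψ := by
  have hs := smoothOn_groupCoord s
  simp only [sklyaninForm_eq s (hφ.add hφ') hψ, sklyaninForm_eq s hφ hψ, sklyaninForm_eq s hφ' hψ,
    Matrix.transpose_add, Matrix.mul_add, Matrix.add_mul]
  rw [pv_casimirForm_add_left (hφ.transpose.mul_left hs) (hφ'.transpose.mul_left hs)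
      (hψ.transpose.mul_left hs),
    pv_casimirForm_add_left (hφ.transpose.mul_right hs) (hφ'.transpose.mul_right hs)
      (hψ.transpose.mul_right hs)]
  ring

theorem sklyaninForm_smul_left (s : Group I) (r : ℝ) {φ ψ : ℝ → Mat} (hφ : IsTest I φ)
    (hψ : IsTest I ψ) :
    sklyaninForm s (fun w => r • φ w) ψ = r * sklyaninForm s φ ψ := by
  have hs := smoothOn_groupCoord s
  simp only [sklyaninForm_eq s (hφ.const_smul r) hψ, sklyaninForm_eq s hφ hψ,
    Matrix.transpose_smul, Matrix.mul_smul, Matrix.smul_mul]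
  rw [pv_casimirForm_smul_left r (hφ.transpose.mul_left hs) (hψ.transpose.mul_left hs),
    pv_casimirForm_smul_left r (hφ.transpose.mul_right hs) (hψ.transpose.mul_right hs)]
  ring

/-- The right momentum is the left one conjugated by s, so both shift by the same scalar and both
Casimir forms are unchanged. -/
theorem sklyaninForm_congr_left {s : Group I} {φ φ' : ℝ → Mat} (h : SameCovector s φ φ')
    (ψ : ℝ → Mat) : sklyaninForm s φ ψ = sklyaninForm s φ' ψ := by
  rw [sklyaninForm, sklyaninForm]
  congr 1
  funext v w
  obtain ⟨c, hc⟩ := h v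
  have h1 : (φ v)ᵀ * groupCoord I s v = (φ' v)ᵀ * groupCoord I s v + c • 1 := by
    have := congrArg (fun X => (groupCoord I s v).adjugate * X * groupCoord I s v) hc
    simpa [← Matrix.mul_assoc, adjugate_mul_groupCoord, Matrix.mul_add, Matrix.add_mul] using this
  rw [contract_sklyaninKernel, contract_sklyaninKernel, hc, h1, casimirForm_add_scalar_left,
    casimirForm_add_scalar_left]

theorem sklyaninForm_congr {s : Group I} {φ φ' ψ ψ' : ℝ → Mat} (h : SameCovector s φ φ')
    (h' : SameCovector s ψ ψ') (hφ' : IsTest I φ') (hψ : IsTest I ψ) (hψ' : IsTest I ψ') :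
    sklyaninForm s φ ψ = sklyaninForm s φ' ψ' := by
  rw [sklyaninForm_congr_left h, sklyaninForm_swap s hψ hφ', sklyaninForm_congr_left h',
    ← sklyaninForm_swap s hψ' hφ']

/-- The Sklyanin bracket of two observables on the Geroch group. -/
noncomputable def sklyaninBracket (I : Set ℝ) : Bracket I where
  br A B s := sklyaninForm s (functionalDeriv I (groupCoord I) A s)
    (functionalDeriv I (groupCoord I) B s)
  skew A B hA hB s := by
    rw [sklyaninForm_swap s (hB.hasFunctionalDeriv s).1 (hA.hasFunctionalDeriv s).1]
  add_left A A' B hA hA' hB s := by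
    have h1 := hA.hasFunctionalDeriv s
    have h2 := hA'.hasFunctionalDeriv s
    rw [← sklyaninForm_add_left s h1.1 h2.1 (hB.hasFunctionalDeriv s).1]
    exact sklyaninForm_congr_left ((h1.add h2).functionalDeriv.group_unique (h1.add h2)) _
  smul_left r A B hA hB s := by
    have h1 := hA.hasFunctionalDeriv s
    rw [← sklyaninForm_smul_left s r h1.1 (hB.hasFunctionalDeriv s).1]
    exact sklyaninForm_congr_left
      ((h1.const_smul r).functionalDeriv.group_unique (h1.const_smul r)) _
  leibniz A A' B hA hA' hB s := by
    have h1 := hA.hasFunctionalDeriv s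
    have h2 := hA'.hasFunctionalDeriv s
    have h3 := (hB.hasFunctionalDeriv s).1
    rw [← sklyaninForm_smul_left s _ h1.1 h3, ← sklyaninForm_smul_left s _ h2.1 h3,
      ← sklyaninForm_add_left s (h2.1.const_smul _) (h1.1.const_smul _) h3]
    exact sklyaninForm_congr_left ((h1.mul h2).functionalDeriv.group_unique (h1.mul h2)) _
  chain A A' B hA hA' hB s φ h h' := by
    rw [sklyaninForm_congr_left (h.functionalDeriv.group_unique h),
      sklyaninForm_congr_left (h'.functionalDeriv.group_unique h')]

theorem sklyaninBracket_isSklyanin (I : Set ℝ) : (sklyaninBracket I).IsSklyanin := by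
  intro φ ψ hφ hψ s
  have h1 := hasFunctionalDeriv_smear (e := groupCoord I) hφ s
  have h2 := hasFunctionalDeriv_smear (e := groupCoord I) hψ s
  exact sklyaninForm_congr (h1.functionalDeriv.group_unique h1)
    (h2.functionalDeriv.group_unique h2) hφ h2.functionalDeriv.1 hψ

/-! ### Brackets and functional derivatives -/

theorem Bracket.congr (P : Bracket I) {A A' B B' : Group I → ℝ} {s : Group I} {φ ψ : ℝ → Mat}
    (hA : IsObservable I (groupCoord I) A) (hA' : IsObservable I (groupCoord I) A')
    (hB : IsObservable I (groupCoord I) B) (hB' : IsObservable I (groupCoord I) B')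
    (h : HasFunctionalDeriv I (groupCoord I) A s φ)
    (h' : HasFunctionalDeriv I (groupCoord I) A' s φ)
    (k : HasFunctionalDeriv I (groupCoord I) B s ψ)
    (k' : HasFunctionalDeriv I (groupCoord I) B' s ψ) : P.br A B s = P.br A' B' s := by
  rw [P.chain A A' B hA hA' hB s φ h h', P.skew A' B hA' hB, P.chain B B' A' hB hB' hA' s ψ k k',
    P.skew A' B' hA' hB']

theorem IsObservable.smul_right {A : PhaseSpace I → ℝ} (hA : IsObservable I (phaseCoord I) A)
    (ξ : PhaseSpace I) : IsObservable I (groupCoord I) (fun h => A (h • ξ)) :=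
  fun g => ⟨_, (hA.hasFunctionalDeriv (g • ξ)).smul_right g ξ⟩

/-- The phase space bracket fails to be invariant under the action of `g` by the Sklyanin
bracket. -/
theorem phaseBracket_smul {A B : PhaseSpace I → ℝ} {g : Group I} {ξ : PhaseSpace I}
    {φ ψ : ℝ → Mat} (hA : HasFunctionalDeriv I (phaseCoord I) A (g • ξ) φ)
    (hB : HasFunctionalDeriv I (phaseCoord I) B (g • ξ) ψ) :
    phaseBracket I A B (g • ξ) =
      phaseBracket I (fun η => A (g • η)) (fun η => B (g • η)) ξ
        + sklyaninForm g (fun w => (φ w + (φ w)ᵀ) * (groupCoord I g w * phaseCoord I ξ w))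
          (fun w => (ψ w + (ψ w)ᵀ) * (groupCoord I g w * phaseCoord I ξ w)) := by
  rw [phaseBracket_eq hA hB, phaseBracket_eq (hA.smul_left g ξ) (hB.smul_left g ξ),
    sklyaninForm_eq g (hA.smul_right g ξ).1 (hB.smul_right g ξ).1]
  -- The left momentum of the pullback to the group is the phase space momentum at `g • ξ`.
  have h1 : ∀ (φ : ℝ → Mat) w, groupCoord I g w * ((φ w + (φ w)ᵀ) *
      (groupCoord I g w * phaseCoord I ξ w))ᵀ = phaseCoord I (g • ξ) w * (φ w + (φ w)ᵀ) := by
    intro φ w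
    rw [phaseCoord_smul, Matrix.transpose_mul, Matrix.transpose_mul, phaseCoord_transpose,
      Matrix.transpose_add, Matrix.transpose_transpose, add_comm (φ w)ᵀ]
    simp only [Matrix.mul_assoc]
  -- Its right momentum is the momentum at `ξ` of the observable translated by `g`.
  have h2 : ∀ (φ : ℝ → Mat) w, ((φ w + (φ w)ᵀ) * (groupCoord I g w * phaseCoord I ξ w))ᵀ
      * groupCoord I g w = phaseCoord I ξ w * ((groupCoord I g w)ᵀ * φ w * groupCoord I g w
        + ((groupCoord I g w)ᵀ * φ w * groupCoord I g w)ᵀ) := by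
    intro φ w
    simp only [Matrix.transpose_mul, phaseCoord_transpose, Matrix.transpose_add,
      Matrix.transpose_transpose, Matrix.mul_add, Matrix.add_mul, Matrix.mul_assoc]
    rw [add_comm]
  simp only [h1, h2]
  ring

/-- The chain rule replaces `A` and `B` by the smeared coordinates with the same derivatives at `s`,
where the bracket is known. -/
theorem Bracket.IsSklyanin.br_eq {P : Bracket I} (hP : P.IsSklyanin) {A B : Group I → ℝ}
    {s : Group I} {φ ψ : ℝ → Mat} (hA : IsObservable I (groupCoord I) A)
    (hB : IsObservable I (groupCoord I) B) (h : HasFunctionalDeriv I (groupCoord I) A s φ)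
    (k : HasFunctionalDeriv I (groupCoord I) B s ψ) : P.br A B s = sklyaninForm s φ ψ :=
  (P.congr hA (isObservable_smear h.1) hB (isObservable_smear k.1) h
    (hasFunctionalDeriv_smear h.1 s) k (hasFunctionalDeriv_smear k.1 s)).trans
    (hP φ ψ h.1 k.1 s)

theorem Bracket.IsSklyanin.actionIsPoisson {P : Bracket I} (hP : P.IsSklyanin) :
    P.ActionIsPoisson := by
  intro A B hA hB g ξ
  have h := hA.hasFunctionalDeriv (g • ξ)
  have k := hB.hasFunctionalDeriv (g • ξ)
  rw [phaseBracket_smul h k, hP.br_eq (hA.smul_right ξ) (hB.smul_right ξ) (h.smul_right g ξ)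
    (k.smul_right g ξ)]

/-! ### Brackets for which the action is Poisson -/

/-- The bracket `P` agrees at `s` with the Sklyanin bracket on the matrix elements smeared with
`φ` and `ψ`. -/
def Bracket.AgreesOn (P : Bracket I) (s : Group I) (φ ψ : ℝ → Mat) : Prop :=
  P.br (smear (groupCoord I) φ) (smear (groupCoord I) ψ) s = sklyaninForm s φ ψ

theorem Bracket.AgreesOn.symm {P : Bracket I} {s : Group I} {φ ψ : ℝ → Mat} (hφ : IsTest I φ)
    (hψ : IsTest I ψ) (h : P.AgreesOn s φ ψ) : P.AgreesOn s ψ φ := by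
  rw [Bracket.AgreesOn, P.skew _ _ (isObservable_smear hψ) (isObservable_smear hφ), h,
    sklyaninForm_swap s hφ hψ]

theorem Bracket.AgreesOn.congr_left {P : Bracket I} {s : Group I} {φ φ' ψ : ℝ → Mat}
    (hφ : IsTest I φ) (hφ' : IsTest I φ') (hψ : IsTest I ψ) (h : P.AgreesOn s φ ψ)
    (hs : SameCovector s φ φ') : P.AgreesOn s φ' ψ := by
  rw [Bracket.AgreesOn, ← sklyaninForm_congr_left hs, ← h]
  exact P.chain _ _ _ (isObservable_smear hφ') (isObservable_smear hφ) (isObservable_smear hψ) s φ'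
    (hasFunctionalDeriv_smear hφ' s) ((hasFunctionalDeriv_smear hφ s).group_congr hφ' hs)

theorem Bracket.AgreesOn.add_left {P : Bracket I} {s : Group I} {φ φ' ψ : ℝ → Mat}
    (hφ : IsTest I φ) (hφ' : IsTest I φ') (hψ : IsTest I ψ) (h : P.AgreesOn s φ ψ)
    (h' : P.AgreesOn s φ' ψ) : P.AgreesOn s (fun w => φ w + φ' w) ψ := by
  have o := isObservable_smear (e := groupCoord I) hφ
  have o' := isObservable_smear (e := groupCoord I) hφ'
  rw [Bracket.AgreesOn, sklyaninForm_add_left s hφ hφ' hψ, ← h, ← h',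
    ← P.add_left _ _ _ o o' (isObservable_smear hψ)]
  exact P.chain _ _ _ (isObservable_smear (hφ.add hφ')) (o.add o') (isObservable_smear hψ) s _
    (hasFunctionalDeriv_smear (hφ.add hφ') s)
    ((hasFunctionalDeriv_smear hφ s).add (hasFunctionalDeriv_smear hφ' s))

/-! ### Momenta reached by pullbacks at constant metrics -/

/-- The covector at `s` with `s φᵗ = f E`. -/
def covector (s : Group I) (f : ℝ → ℝ) (E : Mat) (w : ℝ) : Mat :=
  f w • ((groupCoord I s w).adjugate * E)ᵀ

theorem isTest_covector (s : Group I) {f : ℝ → ℝ} (hf : IsScalarTest I f) (E : Mat) :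
    IsTest I (covector s f E) :=
  hf.smul ((smoothOn_groupCoord s).adjugate.mul (EntrySmooth.const E)).transpose

theorem groupCoord_mul_covector (s : Group I) (f : ℝ → ℝ) (E : Mat) (w : ℝ) :
    groupCoord I s w * (covector s f E w)ᵀ = f w • E := by
  rw [covector, Matrix.transpose_smul, Matrix.transpose_transpose, Matrix.mul_smul,
    ← Matrix.mul_assoc, groupCoord_mul_adjugate, Matrix.one_mul]

open Classical in
/-- The constant functions in the phase space. -/
noncomputable def constPhase (I : Set ℝ) (M : Mat) (hM : M.PosDef) (hM' : M.det = 1) :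
    PhaseSpace I :=
  ⟨fun w => if w ∈ I then M else 1,
    fun i j => (contDiffOn_const (c := M i j)).congr fun w hw => by simp [hw],
    fun w => by
      by_cases hw : w ∈ I
      · simpa [hw] using ⟨hM, hM'⟩
      · simpa [hw] using Matrix.PosDef.one,
    fun w hw => by simp [hw]⟩

theorem phaseCoord_constPhase {M : Mat} {hM : M.PosDef} {hM' : M.det = 1} {w : ℝ} (hw : w ∈ I) :
    phaseCoord I (constPhase I M hM hM') w = M := if_pos hw

/-- The functional derivative of a smeared matrix element `A` of `ℳ` at a constant `M`, pulled back
along `h ↦ A (h ▷ ξ)`, has momentum `f E` if `E M` is symmetric. -/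
theorem sameCovector_constPhase (s : Group I) {f : ℝ → ℝ} (hf : IsScalarTest I f) {E M : Mat}
    (hM : M.PosDef) (hM' : M.det = 1) (hE : (E * M).IsSymm) (ξ : PhaseSpace I)
    (hξ : s • ξ = constPhase I M hM hM') :
    SameCovector s (fun w => (f w • ((1 / 2 : ℝ) • (M.adjugate * E)) +
      (f w • ((1 / 2 : ℝ) • (M.adjugate * E)))ᵀ) * (groupCoord I s w * phaseCoord I ξ w))
      (covector s f E) := by
  intro w
  refine ⟨0, ?_⟩
  rw [groupCoord_mul_covector, zero_smul, add_zero]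
  by_cases hw : w ∈ I
  swap
  · simp [hf.eq_zero hw]
  have h1 : phaseCoord I (s • ξ) w = M := by rw [hξ, phaseCoord_constPhase hw]
  rw [phaseCoord_smul] at h1
  have hMs : Mᵀ = M := by
    ext i j
    exact hM.isHermitian.apply i j
  have hMa : M * M.adjugate = 1 := by rw [Matrix.mul_adjugate, hM', one_smul]
  have haM : M.adjugate * M = 1 := by rw [Matrix.adjugate_mul, hM', one_smul]
  -- As M is symmetric with inverse `M.adjugate`, symmetry of EM is equivalent to symmetry of M⁻¹E.
  -- Symmetrising M⁻¹E then doubles it, which the factor 1/2 compensates.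
  have h2 : (M.adjugate * E)ᵀ = M.adjugate * E := by
    have h3 : M * Eᵀ = E * M := by
      have := hE.eq
      rwa [Matrix.transpose_mul, hMs] at this
    rw [Matrix.transpose_mul, Matrix.adjugate_transpose, hMs]
    calc Eᵀ * M.adjugate = M.adjugate * (M * Eᵀ) * M.adjugate := by
          rw [← Matrix.mul_assoc, haM, Matrix.one_mul]
      _ = M.adjugate * E := by
          rw [h3, Matrix.mul_assoc, Matrix.mul_assoc, hMa, Matrix.mul_one]
  have h4 : f w • ((1 / 2 : ℝ) • (M.adjugate * E)) + (f w • ((1 / 2 : ℝ) • (M.adjugate * E)))ᵀ =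
      f w • (M.adjugate * E) := by
    rw [Matrix.transpose_smul, Matrix.transpose_smul, h2]
    module
  beta_reduce
  rw [h4, Matrix.transpose_mul, Matrix.transpose_mul, Matrix.transpose_smul, h2,
    phaseCoord_transpose, ← Matrix.mul_assoc, ← Matrix.mul_assoc, h1, Matrix.mul_smul,
    ← Matrix.mul_assoc, hMa, Matrix.one_mul]

/-- The test observables are matrix elements smeared with fM⁻¹E/2 and gM⁻¹F/2. Comparing the Poisson
property with `phaseBracket_smul` cancels the phase space brackets and leaves the two group brackets
of the pullbacks. -/
theorem Bracket.ActionIsPoisson.agreesOn_covector {P : Bracket I} (hP : P.ActionIsPoisson)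
    (s : Group I) {f g : ℝ → ℝ} (hf : IsScalarTest I f) (hg : IsScalarTest I g) {E F M : Mat}
    (hM : M.PosDef) (hM' : M.det = 1) (hE : (E * M).IsSymm) (hF : (F * M).IsSymm) :
    P.AgreesOn s (covector s f E) (covector s g F) := by
  -- Chosen so that `s • ξ` is the constant M, whatever `s` is.
  set ξ : PhaseSpace I := s⁻¹ • constPhase I M hM hM' with hξ
  have hξ' : s • ξ = constPhase I M hM hM' := smul_inv_smul _ _
  have hχ : ∀ {f : ℝ → ℝ}, IsScalarTest I f → ∀ E : Mat,
      IsTest I (fun w => f w • ((1 / 2 : ℝ) • (M.adjugate * E))) :=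
    fun hf E => hf.smul (EntrySmooth.const _)
  have hA := isObservable_smear (e := phaseCoord I) (hχ hf E)
  have hB := isObservable_smear (e := phaseCoord I) (hχ hg F)
  have h := (hasFunctionalDeriv_smear (e := phaseCoord I) (hχ hf E) (s • ξ))
  have k := (hasFunctionalDeriv_smear (e := phaseCoord I) (hχ hg F) (s • ξ))
  have hE' := sameCovector_constPhase s hf hM hM' hE ξ hξ'
  have hF' := sameCovector_constPhase s hg hM hM' hF ξ hξ'
  have h1 := hP _ _ hA hB s ξ
  rw [phaseBracket_smul h k] at h1
  have hE'' := isTest_covector s hf E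
  have hF'' := isTest_covector s hg F
  rw [Bracket.AgreesOn, ← sklyaninForm_congr hE' hF' hE'' (k.smul_right s ξ).1 hF'',
    add_left_cancel h1]
  exact P.congr (isObservable_smear hE'') (hA.smul_right ξ) (isObservable_smear hF'')
    (hB.smul_right ξ) (hasFunctionalDeriv_smear hE'' s)
    ((h.smul_right s ξ).group_congr hE'' hE') (hasFunctionalDeriv_smear hF'' s)
    ((k.smul_right s ξ).group_congr hF'' hF')

/-! ### Reduction to two bases of the traceless matrices -/

/-- If `E₀, E₁, E₂` is a basis of the traceless matrices, with dual basis `X ↦ tr (Cₖ X)`, then it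
suffices to check covectors along the `Eₖ`. -/
theorem Bracket.agreesOn_of_basis {P : Bracket I} {s : Group I} {ψ : ℝ → Mat} (hψ : IsTest I ψ)
    (E C : Fin 3 → Mat)
    (hC : ∀ X : Mat, X = ((trace (C 0 * X)) • E 0 + (trace (C 1 * X)) • E 1)
      + (trace (C 2 * X)) • E 2 + (trace X / 2) • 1)
    (h : ∀ k f, IsScalarTest I f → P.AgreesOn s (covector s f (E k)) ψ) {φ : ℝ → Mat}
    (hφ : IsTest I φ) : P.AgreesOn s φ ψ := by
  have hf : ∀ k, IsScalarTest I (fun w => trace (C k * (groupCoord I s w * (φ w)ᵀ))) := fun k =>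
    (hφ.transpose.mul_left (smoothOn_groupCoord s)).trace_mul (EntrySmooth.const (C k))
  have ht := fun k => isTest_covector s (hf k) (E k)
  refine Bracket.AgreesOn.congr_left (((ht 0).add (ht 1)).add (ht 2)) hφ hψ
    (Bracket.AgreesOn.add_left ((ht 0).add (ht 1)) (ht 2) hψ
      (Bracket.AgreesOn.add_left (ht 0) (ht 1) hψ (h 0 _ (hf 0)) (h 1 _ (hf 1)))
      (h 2 _ (hf 2))) (SameCovector.symm fun w => ?_)
  -- The basis captures only the traceless part of the momentum; the remaining multiple of 1 is
  -- invisible to the covector.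
  refine ⟨trace (groupCoord I s w * (φ w)ᵀ) / 2, ?_⟩
  simp only [Matrix.transpose_add, Matrix.mul_add, groupCoord_mul_covector]
  exact hC _

/-- The symmetry conditions are linear in M, so any positive definite solution can be rescaled to
determinant 1. -/
theorem exists_posDef_isSymm {E F : Mat} (x y z : ℝ) (hx : 0 < x) (hd : y ^ 2 < x * z)
    (hE : (E * !![x, y; y, z]).IsSymm) (hF : (F * !![x, y; y, z]).IsSymm) :
    ∃ M : Mat, M.PosDef ∧ M.det = 1 ∧ (E * M).IsSymm ∧ (F * M).IsSymm := by
  have hd' : 0 < x * z - y ^ 2 := sub_pos.2 hd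
  have hr : 0 < (√(x * z - y ^ 2))⁻¹ := inv_pos.2 (Real.sqrt_pos.2 hd')
  refine ⟨(√(x * z - y ^ 2))⁻¹ • !![x, y; y, z], Matrix.PosDef.smul ?_ hr, ?_, ?_, ?_⟩
  · refine Matrix.PosDef.of_dotProduct_mulVec_pos ?_ fun v hv => ?_
    · ext i j
      fin_cases i <;> fin_cases j <;> rfl
    · simp only [dotProduct, Matrix.mulVec, Fin.sum_univ_two, Matrix.of_apply, Matrix.cons_val',
        Matrix.cons_val_zero, Matrix.cons_val_one, Matrix.cons_val_fin_one, Pi.star_apply,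
        star_trivial]
      -- Completing the square: this is x times the quadratic form at v.
      have h1 : 0 < (x * v 0 + y * v 1) ^ 2 + (x * z - y ^ 2) * v 1 ^ 2 := by
        rcases eq_or_ne (v 1) 0 with h | h
        · have h0 : v 0 ≠ 0 := fun h0 => hv (by
            ext i
            fin_cases i
            · exact h0
            · exact h)
          rw [h]
          simp only [mul_zero, add_zero, ne_eq, OfNat.ofNat_ne_zero, not_false_eq_true, zero_pow]
          positivity
        · positivity
      refine pos_of_mul_pos_right (a := x) ?_ hx.le
      linarith
  · rw [Matrix.det_smul, Matrix.det_fin_two_of, Fintype.card_fin, inv_pow, Real.sq_sqrt hd'.le]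
    rw [← pow_two]
    exact inv_mul_cancel₀ hd'.ne'
  · rw [Matrix.mul_smul]
    exact hE.smul _
  · rw [Matrix.mul_smul]
    exact hF.smul _

/-- Two bases of the traceless matrices such that any element of the first and any element of the
second are both symmetric with respect to a common positive definite form. -/
theorem exists_bases : ∃ E C F D : Fin 3 → Mat,
    (∀ X : Mat, X = ((trace (C 0 * X)) • E 0 + (trace (C 1 * X)) • E 1)
      + (trace (C 2 * X)) • E 2 + (trace X / 2) • 1) ∧
    (∀ X : Mat, X = ((trace (D 0 * X)) • F 0 + (trace (D 1 * X)) • F 1)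
      + (trace (D 2 * X)) • F 2 + (trace X / 2) • 1) ∧
    ∀ k l, ∃ M : Mat, M.PosDef ∧ M.det = 1 ∧ (E k * M).IsSymm ∧ (F l * M).IsSymm := by
  -- In the standard basis h, e, f of the traceless matrices, the first basis is h, h + e, h + f and
  -- the second is e + f, e + 2f, e + f − h. A pair has a common M because the trace form is
  -- positive definite on its span. The other two families represent the dual bases.
  refine ⟨![!![1, 0; 0, -1], !![1, 1; 0, -1], !![1, 0; 1, -1]],
    ![!![1 / 2, -1; -1, -1 / 2], !![0, 0; 1, 0], !![0, 1; 0, 0]],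
    ![!![0, 1; 1, 0], !![0, 1; 2, 0], !![-1, 1; 1, 1]],
    ![!![1 / 2, -1; 2, -1 / 2], !![0, 1; -1, 0], !![-1 / 2, 0; 0, 1 / 2]], ?_, ?_, ?_⟩
  · intro X
    ext i j
    fin_cases i <;> fin_cases j <;>
      simp [Matrix.trace_fin_two, Matrix.mul_apply, Fin.sum_univ_two, -Matrix.cons_mul] <;> ring
  · intro X
    ext i j
    fin_cases i <;> fin_cases j <;>
      simp [Matrix.trace_fin_two, Matrix.mul_apply, Fin.sum_univ_two, -Matrix.cons_mul] <;> ring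
  -- The equation 2py + qz = rx says that the off-diagonal entries of the product agree. Each pair
  -- gives two such linear equations, solved below by the last three numbers x, y, z.
  · have key : ∀ (p q r p' q' r' x y z : ℝ), 0 < x → y ^ 2 < x * z →
        2 * p * y + q * z = r * x → 2 * p' * y + q' * z = r' * x →
        ∃ M : Mat, M.PosDef ∧ M.det = 1 ∧ (!![p, q; r, -p] * M).IsSymm ∧
          (!![p', q'; r', -p'] * M).IsSymm := by
      intro p q r p' q' r' x y z hx hd h h'
      refine exists_posDef_isSymm x y z hx hd ?_ ?_
      · refine Matrix.IsSymm.ext fun i j => ?_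
        fin_cases i <;> fin_cases j <;> simp <;> linarith
      · refine Matrix.IsSymm.ext fun i j => ?_
        fin_cases i <;> fin_cases j <;> simp <;> linarith
    intro k l
    fin_cases k <;> fin_cases l
    · simpa using key 1 0 0 0 1 1 1 0 1 (by norm_num) (by norm_num) (by norm_num) (by norm_num)
    · simpa using key 1 0 0 0 1 2 1 0 2 (by norm_num) (by norm_num) (by norm_num) (by norm_num)
    · simpa using key 1 0 0 (-1) 1 1 1 0 1 (by norm_num) (by norm_num) (by norm_num) (by norm_num)
    · simpa using key 1 1 0 0 1 1 1 (-1 / 2) 1 (by norm_num) (by norm_num) (by norm_num)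
        (by norm_num)
    · simpa using key 1 1 0 0 1 2 1 (-1) 2 (by norm_num) (by norm_num) (by norm_num) (by norm_num)
    · simpa using key 1 1 0 (-1) 1 1 2 (-1 / 2) 1 (by norm_num) (by norm_num) (by norm_num)
        (by norm_num)
    · simpa using key 1 0 1 0 1 1 1 (1 / 2) 1 (by norm_num) (by norm_num) (by norm_num)
        (by norm_num)
    · simpa using key 1 0 1 0 1 2 1 (1 / 2) 2 (by norm_num) (by norm_num) (by norm_num)
        (by norm_num)
    · simpa using key 1 0 1 (-1) 1 1 1 (1 / 2) 2 (by norm_num) (by norm_num) (by norm_num)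
        (by norm_num)

theorem Bracket.ActionIsPoisson.isSklyanin {P : Bracket I} (hP : P.ActionIsPoisson) :
    P.IsSklyanin := by
  intro φ ψ hφ hψ s
  obtain ⟨E, C, F, D, hC, hD, hM⟩ := exists_bases
  refine Bracket.agreesOn_of_basis hψ E C hC (fun k f hf => ?_) hφ
  -- The basis reduction acts on the first argument only, so the arguments are exchanged before it
  -- is applied with the second basis.
  refine Bracket.AgreesOn.symm hψ (isTest_covector s hf _)
    (Bracket.agreesOn_of_basis (isTest_covector s hf _) F D hD (fun l g hg => ?_) hψ)
  obtain ⟨M, h1, h2, h3, h4⟩ := hM k l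
  exact hP.agreesOn_covector s hg hf h1 h2 h4 h3

end Brackets

end Geroch

theorem mainTheorem1 (I : Set ℝ) (hI : I.OrdConnected) (hI' : I.Nontrivial) :
    (∀ P : Geroch.Bracket I, P.ActionIsPoisson ↔ P.IsSklyanin) ∧
      ∃ P : Geroch.Bracket I, P.IsSklyanin :=
  ⟨fun _ => ⟨fun h => h.isSklyanin, fun h => h.actionIsPoisson⟩,
    Geroch.sklyaninBracket I, Geroch.sklyaninBracket_isSklyanin I⟩
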